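/- **Conventions.** A family $\mathcal F$ of finite subsets of $\mathbb N$ is *compact* if it is compact as a subset of $\{0,1\}^{\mathbb N}$ (sets being identified with their characteristic functions), *hereditary* if $s\subseteq t\in\mathcal F$ implies $s\in\mathcal F$, and *spreading* if $\{s_1<\dots<s_d\}\in\mathcal F$ and $s_i\le t_i$ for all $i$, where $t_1<\dots<t_d$, imply $\{t_1,\dots,t_d\}\in\mathcal F$; it is *regular* if it has all three properties. Let $\partial\mathcal F$ be the set of proper accumulation points of $\mathcal F$, $\partial^{(0)}\mathcal F=\mathcal F$ and $\partial^{(\alpha)}\mathcal F=\bigcap_{\beta<\alpha}\partial(\partial^{(\beta)}\mathcal F)$ for $\alpha>0$; the *index* $\iota(\mathcal F)$ of a compact family is the least ordinal $\alpha$ with $\partial^{(\alpha)}\mathcal F\subseteq\{\emptyset\}$. A sequence $(E_j)_{j=1}^n$ of nonempty finite sets is *$\mathcal F$-admissible* if there is $\{m_1<\dots<m_n\}\in\mathcal F$ with $m_1\le \min E_1\le\max E_1<m_2\le\min E_2\le\max E_2<\dots<m_n\le\min E_n$. For compact hereditary families $\mathcal F_i$ and $0<\theta_i<1$ ($1\le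 i\le r$), $T[(\mathcal F_i,\theta_i)_{i=1}^r]$ is the completion of $c_{00}$ (over $\mathbb R$) for the norm determined by $$\|x\|=\max\Big\{\|x\|_\infty,\ \sup\Big\{\theta_i\sum_{j=1}^n\|E_jx\| : 1\le i\le r,\ (E_j)_{j=1}^n\ \mathcal F_i\text{-admissible}\Big\}\Big\},$$ where $E_jx$ is the restriction of $x$ to $E_j$; $(e_n)$ denotes its natural basis, and $T(\mathcal F,\theta)=T[(\mathcal F,\theta)]$. Every ordinal $\alpha>0$ is uniquely $\alpha=\omega^{\lambda(\alpha)}k(\alpha)+\xi(\alpha)$ with $0<k(\alpha)<\omega$ and $\xi(\alpha)<\omega^{\lambda(\alpha)}$. Put $\gamma(\alpha)=\alpha$, $n(\alpha)=1$ if $\alpha$ is finite, and $\gamma(\alpha)=\omega^{\omega^{\lambda(\lambda(\alpha))}}$, $n(\alpha)=k(\lambda(\alpha))$ if $\alpha$ is infinite. For pairs of an ordinal and a number in $(0,1)$, write $(\alpha_0,\theta_0)\le_{\mathrm T}(\alpha_1,\theta_1)$ iff either both $\alpha_0,\alpha_1$ are finite and $\log_{\gamma(\alpha_0)}\theta_0\le\log_{\gamma(\alpha_1)}\theta_1$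 (with $\log_a\theta=-\infty$ for $a\le 1$), or at least one of them is infinite and there are integers $m_0,m_1\ge1$ with $\gamma(\alpha_0)^{n(\alpha_0)m_0}\le\gamma(\alpha_1)^{n(\alpha_1)m_1}$ and $\theta_0^{m_0}\le\theta_1^{m_1}$. **Theorem.** Let $(\mathcal B_i,\theta_i)_{i=1}^r$ be a finite sequence of regular families $\mathcal B_i$ and numbers $0<\theta_i<1$, with at least one $\iota(\mathcal B_i)$ infinite. Let $i_0$ be such that $(\iota(\mathcal B_i),\theta_i)\le_{\mathrm T}(\iota(\mathcal B_{i_0}),\theta_{i_0})$ for all $1\le i\le r$. Then for every infinite $M\subseteq\mathbb N$ there is an infinite $N\subseteq M$ such that the subsequence $(e_n)_{n\in N}$ of the natural basis of $T[(\mathcal B_i,\theta_i)_{i=1}^r]$ is equivalent to the subsequence $(e_n)_{n\in N}$ of the natural basis of $T(\mathcal B_{i_0},\theta_{i_0})$; that is, for some $C\ge1$ and all finitely supported real scalars $(a_n)_{n\in N}$, the norms of $\sum_{n\in N}a_ne_n$ in the two spaces differ at most by the factor $C$: $$C^{-1}\Big\|\sum_{n\in N}a_ne_n\Big\|_{(\mathcal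 B_{i_0},\theta_{i_0})}\le\Big\|\sum_{n\in N}a_ne_n\Big\|_{(\mathcal B_i,\theta_i)_{i=1}^r}\le C\Big\|\sum_{n\in N}a_ne_n\Big\|_{(\mathcal B_{i_0},\theta_{i_0})}.$$ -/

import Mathlib

open scoped Topology

noncomputable section

namespace Tsirelson

/-! ### Families of finite sets of integers -/

/-- The characteristic function of a finite set, as a point of the Cantor space. -/
def charFun (s : Finset ℕ) : ℕ → Bool := fun n => decide (n ∈ s)

/-- `F` is compact, as a set of points of the Cantor space. -/
def IsCompactFamily (F : Set (Finset ℕ)) : Prop := IsCompact (charFun '' F)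

/-- `F` is closed under subsets. -/
def IsHereditary (F : Set (Finset ℕ)) : Prop := ∀ t ∈ F, ∀ s, s ⊆ t → s ∈ F

/-- `s ⪯ t`: the sets have the same cardinality, and the `i`-th element of `s` (in increasing
order) is at most the `i`-th element of `t`. -/
def SpreadLE (s t : Finset ℕ) : Prop :=
  ∃ h : t.card = s.card, ∀ i : Fin s.card, s.orderEmbOfFin rfl i ≤ t.orderEmbOfFin h i

/-- `F` is spreading (on `ℕ`). -/
def IsSpreading (F : Set (Finset ℕ)) : Prop := ∀ s ∈ F, ∀ t, SpreadLE s t → t ∈ F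

/-- The finite sets that are proper accumulation points of `F` in the Cantor space. -/
def cbDerivative (F : Set (Finset ℕ)) : Set (Finset ℕ) :=
  {s | AccPt (charFun s) (Filter.principal (charFun '' F))}

/-- The iterated derivatives: the `α`-th one is the intersection over all `β < α` of the
derivative of the `β`-th one; for `α = 0` it is `F`. -/
def cbIter (F : Set (Finset ℕ)) (α : Ordinal.{0}) : Set (Finset ℕ) :=
  {s | s ∈ F ∧ ∀ β : Ordinal.{0}, ∀ _ : β < α, s ∈ cbDerivative (cbIter F β)}
termination_by α

/-- The Cantor-Bendixson index: the least `α` such that the `α`-th derivative is contained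
in `{∅}`. -/
def cbIndex (F : Set (Finset ℕ)) : Ordinal.{0} := sInf {α | cbIter F α ⊆ {∅}}

/-- `(E_j)_{j < n}` is an `F`-admissible sequence of (nonempty) finite sets: there is
`{m_0 < ... < m_{n-1}} ∈ F` with `m_0 ≤ E_0 < m_1 ≤ E_1 < ... < m_{n-1} ≤ E_{n-1}`. -/
def IsAdmissible (F : Set (Finset ℕ)) {n : ℕ} (E : Fin n → Finset ℕ) : Prop :=
  (∀ j, (E j).Nonempty) ∧
    ∃ m : Fin n → ℕ, StrictMono m ∧ Finset.univ.image m ∈ F ∧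
      (∀ j, ∀ k ∈ E j, m j ≤ k) ∧ ∀ i j, i < j → ∀ k ∈ E i, k < m j

/-! ### The comparison of pairs `(α, θ)` -/

/-- The exponent `λ(α)` in the decomposition `α = ω ^ λ(α) * k(α) + ξ(α)` with `0 < k(α) < ω` and
`ξ(α) < ω ^ λ(α)`, for `α > 0`. -/
def lam (α : Ordinal.{0}) : Ordinal.{0} := Ordinal.log Ordinal.omega0 α

/-- The coefficient `k(α)` in that decomposition, as a (finite) ordinal. -/
def coeff (α : Ordinal.{0}) : Ordinal.{0} := α / Ordinal.omega0 ^ lam α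

open Classical in
/-- `γ(α)` is `α` for finite `α`, and `ω ^ (ω ^ λ(λ(α)))` for infinite `α`. -/
def gam (α : Ordinal.{0}) : Ordinal.{0} :=
  if α < Ordinal.omega0 then coeff α else Ordinal.omega0 ^ (Ordinal.omega0 ^ lam (lam α))

open Classical in
/-- `n(α)` is `1` for finite `α`, and `k(λ(α))` for infinite `α`, as a (finite) ordinal. -/
def nn (α : Ordinal.{0}) : Ordinal.{0} :=
  if α < Ordinal.omega0 then 1 else coeff (lam α)

/-- `log_a θ` for `0 < θ < 1`, with the value `-∞` for the degenerate bases `a ≤ 1`. -/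
def logBase (a : ℕ) (θ : ℝ) : EReal := if a ≤ 1 then ⊥ else ((Real.logb a θ : ℝ) : EReal)

/-- The relation `(α₀, θ₀) ≤_T (α₁, θ₁)`. -/
def TLe (α₀ : Ordinal.{0}) (θ₀ : ℝ) (α₁ : Ordinal.{0}) (θ₁ : ℝ) : Prop :=
  (α₀ < Ordinal.omega0 ∧ α₁ < Ordinal.omega0 ∧
      ∃ a b : ℕ, gam α₀ = a ∧ gam α₁ = b ∧ logBase a θ₀ ≤ logBase b θ₁) ∨
    (Ordinal.omega0 ≤ max α₀ α₁ ∧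
      ∃ m₀ m₁ : ℕ, 0 < m₀ ∧ 0 < m₁ ∧
        gam α₀ ^ (nn α₀ * (m₀ : Ordinal.{0})) ≤ gam α₁ ^ (nn α₁ * (m₁ : Ordinal.{0})) ∧
        θ₀ ^ m₀ ≤ θ₁ ^ m₁)

/-! ### Mixed Tsirelson norms -/

/-- A sequence of pairs `(F_i, θ_i)`, `i ∈ I`, of compact hereditary families and real numbers
`0 < θ_i < 1`. -/
structure PairSeq (I : Type) where
  family : I → Set (Finset ℕ)
  theta : I → ℝ
  compact : ∀ i, IsCompactFamily (family i)
  hereditary : ∀ i, IsHereditary (family i)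
  theta_pos : ∀ i, 0 < theta i
  theta_lt_one : ∀ i, theta i < 1

/-- The sequence is regular: every family is, in addition, spreading. -/
def PairSeq.IsRegular {I : Type} (S : PairSeq I) : Prop := ∀ i, IsSpreading (S.family i)

/-- The one-term sequence `(F_i, θ_i)`. -/
def PairSeq.single {I : Type} (S : PairSeq I) (i : I) : PairSeq Unit where
  family _ := S.family i
  theta _ := S.theta i
  compact _ := S.compact i
  hereditary _ := S.hereditary i
  theta_pos _ := S.theta_pos i
  theta_lt_one _ := S.theta_lt_one i

/-- The restriction `E x` of a vector `x ∈ c₀₀` to a finite set `E`. -/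
def restr (E : Finset ℕ) (x : ℕ →₀ ℝ) : ℕ →₀ ℝ := x.filter (· ∈ E)

/-- The supremum norm on `c₀₀`. -/
def supNorm (x : ℕ →₀ ℝ) : ℝ := ⨆ n, |x n|

/-- All values `θ_i ∑_j N (E_j x)` with `i ∈ I` and `(E_j)` an `F_i`-admissible sequence. -/
def admValues {I : Type} (S : PairSeq I) (N : (ℕ →₀ ℝ) → ℝ) (x : ℕ →₀ ℝ) : Set ℝ :=
  {c | ∃ (i : I) (n : ℕ) (E : Fin n → Finset ℕ), IsAdmissible (S.family i) E ∧
    c = S.theta i * ∑ j, N (restr (E j) x)}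

/-- The approximations of the norm: start from the supremum norm and iterate the right-hand side
of the implicit equation. -/
def stage {I : Type} (S : PairSeq I) : ℕ → (ℕ →₀ ℝ) → ℝ
  | 0, x => supNorm x
  | k + 1, x => max (supNorm x) (sSup (admValues S (stage S k) x))

/-- The mixed Tsirelson norm on `c₀₀`. It satisfies the implicit equation
`‖x‖ = max {‖x‖_∞, sup θ_i ∑_j ‖E_j x‖}`, and for finite `I` it is the only solution that vanishes
at `0`: see `isLUB_tnorm` and `tnorm_unique`. -/
def tnorm {I : Type} (S : PairSeq I) (x : ℕ →₀ ℝ) : ℝ := ⨆ k, stage S k x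

/-! #### The norm axioms -/

/-- The `ℓ₁` norm on `c₀₀`. -/
def lone (x : ℕ →₀ ℝ) : ℝ := ∑ n ∈ x.support, |x n|

lemma lone_eq {x : ℕ →₀ ℝ} {A : Finset ℕ} (h : x.support ⊆ A) : lone x = ∑ n ∈ A, |x n| := by
  unfold lone
  refine Finset.sum_subset h fun n _ hn => ?_
  simp [Finsupp.notMem_support_iff.mp hn]

lemma abs_le_lone (x : ℕ →₀ ℝ) (n : ℕ) : |x n| ≤ lone x := by
  by_cases h : n ∈ x.support
  · exact Finset.single_le_sum (f := fun n => |x n|) (fun _ _ => abs_nonneg _) h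
  · rw [Finsupp.notMem_support_iff.mp h, abs_zero]
    exact Finset.sum_nonneg fun _ _ => abs_nonneg _

lemma bdd_abs (x : ℕ →₀ ℝ) : BddAbove (Set.range fun n => |x n|) :=
  ⟨lone x, by rintro _ ⟨n, rfl⟩; exact abs_le_lone x n⟩

lemma abs_le_supNorm (x : ℕ →₀ ℝ) (n : ℕ) : |x n| ≤ supNorm x := le_ciSup (bdd_abs x) n

lemma supNorm_nonneg (x : ℕ →₀ ℝ) : 0 ≤ supNorm x := (abs_nonneg _).trans (abs_le_supNorm x 0)

lemma supNorm_le_lone (x : ℕ →₀ ℝ) : supNorm x ≤ lone x := ciSup_le (abs_le_lone x)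

lemma supNorm_add (x y : ℕ →₀ ℝ) : supNorm (x + y) ≤ supNorm x + supNorm y :=
  ciSup_le fun n => (abs_add_le _ _).trans
    (add_le_add (abs_le_supNorm x n) (abs_le_supNorm y n))

lemma supNorm_smul (c : ℝ) (x : ℕ →₀ ℝ) : supNorm (c • x) = |c| * supNorm x := by
  unfold supNorm
  rw [Real.mul_iSup_of_nonneg (abs_nonneg c)]
  simp [abs_mul]

lemma restr_apply (E : Finset ℕ) (x : ℕ →₀ ℝ) (n : ℕ) :
    restr E x n = if n ∈ E then x n else 0 := by
  simp [restr, Finsupp.filter_apply]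

lemma restr_add (E : Finset ℕ) (x y : ℕ →₀ ℝ) : restr E (x + y) = restr E x + restr E y := by
  ext n; by_cases h : n ∈ E <;> simp [restr_apply, h]

lemma restr_smul (E : Finset ℕ) (c : ℝ) (x : ℕ →₀ ℝ) : restr E (c • x) = c • restr E x := by
  ext n; by_cases h : n ∈ E <;> simp [restr_apply, h]

lemma support_restr (E : Finset ℕ) (x : ℕ →₀ ℝ) : (restr E x).support ⊆ x.support := by
  intro n; simp [restr_apply]

lemma IsAdmissible.disjoint {F : Set (Finset ℕ)} {n : ℕ} {E : Fin n → Finset ℕ}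
    (h : IsAdmissible F E) {i j : Fin n} {k : ℕ} (hi : k ∈ E i) (hj : k ∈ E j) : i = j := by
  obtain ⟨-, m, -, -, h1, h2⟩ := h
  rcases lt_trichotomy i j with hij | hij | hij
  · exact absurd (h2 i j hij k hi) (not_lt.mpr (h1 j k hj))
  · exact hij
  · exact absurd (h2 j i hij k hj) (not_lt.mpr (h1 i k hi))

lemma sum_lone_le {F : Set (Finset ℕ)} {n : ℕ} {E : Fin n → Finset ℕ}
    (h : IsAdmissible F E) (x : ℕ →₀ ℝ) : ∑ j, lone (restr (E j) x) ≤ lone x := by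
  simp_rw [lone_eq (support_restr _ x)]
  rw [Finset.sum_comm]
  refine Finset.sum_le_sum fun k _ => ?_
  by_cases hk : ∃ j, k ∈ E j
  · obtain ⟨j, hj⟩ := hk
    rw [Finset.sum_eq_single j]
    · simp [restr_apply, hj]
    · intro i _ hij
      have : k ∉ E i := fun hi => hij (h.disjoint hi hj)
      simp [restr_apply, this]
    · simp
  · push Not at hk
    simp [restr_apply, hk]

section

variable {I : Type} (S : PairSeq I)

lemma admValue_le_lone {N : (ℕ →₀ ℝ) → ℝ} (h1 : ∀ x, N x ≤ lone x) (x : ℕ →₀ ℝ) {c : ℝ}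
    (hc : c ∈ admValues S N x) : c ≤ lone x := by
  obtain ⟨i, n, E, hE, rfl⟩ := hc
  have hl : 0 ≤ lone x := Finset.sum_nonneg fun _ _ => abs_nonneg _
  calc S.theta i * ∑ j, N (restr (E j) x) ≤ S.theta i * lone x :=
        mul_le_mul_of_nonneg_left
          ((Finset.sum_le_sum fun j _ => h1 _).trans (sum_lone_le hE x)) (S.theta_pos i).le
    _ ≤ 1 * lone x := mul_le_mul_of_nonneg_right (S.theta_lt_one i).le hl
    _ = lone x := one_mul _

lemma supNorm_le_stage (k : ℕ) (x : ℕ →₀ ℝ) : supNorm x ≤ stage S k x := by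
  cases k with
  | zero => exact le_rfl
  | succ k => exact le_max_left _ _

lemma stage_nonneg (k : ℕ) (x : ℕ →₀ ℝ) : 0 ≤ stage S k x :=
  (supNorm_nonneg x).trans (supNorm_le_stage S k x)

lemma stage_le_lone (k : ℕ) : ∀ x, stage S k x ≤ lone x := by
  induction k with
  | zero => exact supNorm_le_lone
  | succ k ih =>
    intro x
    exact max_le (supNorm_le_lone x)
      (Real.sSup_le (fun c hc => admValue_le_lone S ih x hc)
        ((supNorm_nonneg x).trans (supNorm_le_lone x)))

lemma le_stage_succ (k : ℕ) (x : ℕ →₀ ℝ) {c : ℝ} (hc : c ∈ admValues S (stage S k) x) :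
    c ≤ stage S (k + 1) x :=
  (le_csSup ⟨lone x, fun _ h => admValue_le_lone S (stage_le_lone S k) x h⟩ hc).trans
    (le_max_right _ _)

lemma stage_succ_le {k : ℕ} {x : ℕ →₀ ℝ} {b : ℝ} (h0 : supNorm x ≤ b)
    (h : ∀ c ∈ admValues S (stage S k) x, c ≤ b) : stage S (k + 1) x ≤ b :=
  max_le h0 (Real.sSup_le h ((supNorm_nonneg x).trans h0))

lemma stage_add (k : ℕ) : ∀ x y, stage S k (x + y) ≤ stage S k x + stage S k y := by
  induction k with
  | zero => exact supNorm_add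
  | succ k ih =>
    intro x y
    refine stage_succ_le S ((supNorm_add x y).trans
      (add_le_add (supNorm_le_stage S _ x) (supNorm_le_stage S _ y))) ?_
    rintro _ ⟨i, n, E, hE, rfl⟩
    calc S.theta i * ∑ j, stage S k (restr (E j) (x + y))
        ≤ S.theta i * ∑ j, (stage S k (restr (E j) x) + stage S k (restr (E j) y)) := by
          refine mul_le_mul_of_nonneg_left (Finset.sum_le_sum fun j _ => ?_) (S.theta_pos i).le
          rw [restr_add]; exact ih _ _
      _ = S.theta i * ∑ j, stage S k (restr (E j) x)
          + S.theta i * ∑ j, stage S k (restr (E j) y) := by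
          rw [Finset.sum_add_distrib, mul_add]
      _ ≤ _ := add_le_add (le_stage_succ S k x ⟨i, n, E, hE, rfl⟩)
          (le_stage_succ S k y ⟨i, n, E, hE, rfl⟩)

lemma stage_smul_le (k : ℕ) : ∀ (c : ℝ) (x), stage S k (c • x) ≤ |c| * stage S k x := by
  induction k with
  | zero => exact fun c x => (supNorm_smul c x).le
  | succ k ih =>
    intro c x
    refine stage_succ_le S ?_ ?_
    · rw [supNorm_smul]
      exact mul_le_mul_of_nonneg_left (supNorm_le_stage S _ x) (abs_nonneg c)
    · rintro _ ⟨i, n, E, hE, rfl⟩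
      calc S.theta i * ∑ j, stage S k (restr (E j) (c • x))
          ≤ S.theta i * ∑ j, |c| * stage S k (restr (E j) x) := by
            refine mul_le_mul_of_nonneg_left (Finset.sum_le_sum fun j _ => ?_) (S.theta_pos i).le
            rw [restr_smul]; exact ih _ _
        _ = |c| * (S.theta i * ∑ j, stage S k (restr (E j) x)) := by
            rw [← Finset.mul_sum]; ring
        _ ≤ _ := mul_le_mul_of_nonneg_left (le_stage_succ S k x ⟨i, n, E, hE, rfl⟩) (abs_nonneg c)

lemma bdd_stage (x : ℕ →₀ ℝ) : BddAbove (Set.range fun k => stage S k x) :=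
  ⟨lone x, by rintro _ ⟨k, rfl⟩; exact stage_le_lone S k x⟩

lemma stage_le_tnorm (k : ℕ) (x : ℕ →₀ ℝ) : stage S k x ≤ tnorm S x := le_ciSup (bdd_stage S x) k

lemma tnorm_nonneg (x : ℕ →₀ ℝ) : 0 ≤ tnorm S x := (stage_nonneg S 0 x).trans (stage_le_tnorm S 0 x)

lemma tnorm_add (x y : ℕ →₀ ℝ) : tnorm S (x + y) ≤ tnorm S x + tnorm S y :=
  ciSup_le fun k => (stage_add S k x y).trans
    (add_le_add (stage_le_tnorm S k x) (stage_le_tnorm S k y))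

lemma tnorm_smul_le (c : ℝ) (x : ℕ →₀ ℝ) : tnorm S (c • x) ≤ |c| * tnorm S x :=
  ciSup_le fun k => (stage_smul_le S k c x).trans
    (mul_le_mul_of_nonneg_left (stage_le_tnorm S k x) (abs_nonneg c))

lemma tnorm_zero : tnorm S 0 = 0 := by
  have h := tnorm_smul_le S 0 0
  simp only [smul_zero, abs_zero, zero_mul] at h
  exact le_antisymm h (tnorm_nonneg S 0)

lemma tnorm_smul (c : ℝ) (x : ℕ →₀ ℝ) : tnorm S (c • x) = |c| * tnorm S x := by
  refine le_antisymm (tnorm_smul_le S c x) ?_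
  rcases eq_or_ne c 0 with rfl | hc
  · simp [tnorm_zero]
  · have h := tnorm_smul_le S c⁻¹ (c • x)
    rw [smul_smul, inv_mul_cancel₀ hc, one_smul, abs_inv] at h
    have hc' : 0 < |c| := abs_pos.mpr hc
    calc |c| * tnorm S x ≤ |c| * (|c|⁻¹ * tnorm S (c • x)) :=
          mul_le_mul_of_nonneg_left h hc'.le
      _ = tnorm S (c • x) := by field_simp

lemma eq_zero_of_tnorm {x : ℕ →₀ ℝ} (h : tnorm S x = 0) : x = 0 := by
  ext n
  have := (abs_le_supNorm x n).trans ((supNorm_le_stage S 0 x).trans (stage_le_tnorm S 0 x))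
  rw [h] at this
  simpa using this

lemma stage_mono_succ (k : ℕ) : ∀ x, stage S k x ≤ stage S (k + 1) x := by
  induction k with
  | zero => exact fun x => supNorm_le_stage S 1 x
  | succ k ih =>
    intro x
    refine stage_succ_le S (supNorm_le_stage S _ x) ?_
    rintro _ ⟨i, n, E, hE, rfl⟩
    exact (mul_le_mul_of_nonneg_left (Finset.sum_le_sum fun j _ => ih _) (S.theta_pos i).le).trans
      (le_stage_succ S (k + 1) x ⟨i, n, E, hE, rfl⟩)

/-- The implicit equation: `‖x‖` is the supremum of `‖x‖_∞` and of all `θ_i ∑_j ‖E_j x‖`. -/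
theorem isLUB_tnorm (x : ℕ →₀ ℝ) :
    IsLUB (insert (supNorm x) (admValues S (tnorm S) x)) (tnorm S x) := by
  constructor
  · rintro c (rfl | ⟨i, n, E, hE, rfl⟩)
    · exact (supNorm_le_stage S 0 x).trans (stage_le_tnorm S 0 x)
    · have ht : Filter.Tendsto (fun k => S.theta i * ∑ j, stage S k (restr (E j) x)) Filter.atTop
          (𝓝 (S.theta i * ∑ j, tnorm S (restr (E j) x))) := by
        refine Filter.Tendsto.const_mul _ (tendsto_finsetSum _ fun j _ => ?_)
        have hm : Monotone fun k => stage S k (restr (E j) x) :=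
          monotone_nat_of_le_succ fun k => stage_mono_succ S k _
        exact tendsto_atTop_ciSup hm (bdd_stage S _)
      exact le_of_tendsto' ht fun k =>
        (le_stage_succ S k x ⟨i, n, E, hE, rfl⟩).trans (stage_le_tnorm S _ x)
  · intro b hb
    refine ciSup_le fun k => ?_
    cases k with
    | zero => exact hb (Set.mem_insert _ _)
    | succ k =>
      refine stage_succ_le S (hb (Set.mem_insert _ _)) ?_
      rintro _ ⟨i, n, E, hE, rfl⟩
      exact (mul_le_mul_of_nonneg_left (Finset.sum_le_sum fun j _ => stage_le_tnorm S k _)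
        (S.theta_pos i).le).trans (hb (Set.mem_insert_of_mem _ ⟨i, n, E, hE, rfl⟩))

lemma solution_le [Finite I] {N P : (ℕ →₀ ℝ) → ℝ} (hN0 : N 0 = 0)
    (hN : ∀ x, IsLUB (insert (supNorm x) (admValues S N x)) (N x))
    (hP : ∀ x, IsLUB (insert (supNorm x) (admValues S P x)) (P x)) (d : ℕ) :
    ∀ x : ℕ →₀ ℝ, x.support.card = d → N x ≤ P x := by
  induction d using Nat.strong_induction_on with
  | _ d ih =>
    intro x hx
    by_contra hlt
    push Not at hlt
    have hP0 : 0 ≤ P x := (supNorm_nonneg x).trans ((hP x).1 (Set.mem_insert _ _))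
    have hNpos : 0 < N x := hP0.trans_lt hlt
    have key : ∀ c ∈ admValues S N x, c ≤ P x ∨ ∃ i, c = S.theta i * N x := by
      rintro _ ⟨i, n, E, hE, rfl⟩
      by_cases hfull : ∃ j, restr (E j) x = x
      · right
        obtain ⟨j, hj⟩ := hfull
        refine ⟨i, ?_⟩
        rw [Finset.sum_eq_single j, hj]
        · intro l _ hlj
          have : restr (E l) x = 0 := by
            ext k
            rw [← hj, restr_apply, restr_apply]
            by_cases hk : k ∈ E l
            · have : k ∉ E j := fun h => hlj (hE.disjoint hk h)
              simp [this]
            · simp [hk]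
          rw [this, hN0]
        · simp
      · left
        push Not at hfull
        refine le_trans ?_ ((hP x).1 (Set.mem_insert_of_mem _ ⟨i, n, E, hE, rfl⟩))
        refine mul_le_mul_of_nonneg_left (Finset.sum_le_sum fun j _ => ?_) (S.theta_pos i).le
        refine ih _ ?_ _ rfl
        rw [← hx]
        refine Finset.card_lt_card ((support_restr _ _).ssubset_of_ne fun he => hfull j ?_)
        ext k
        rw [restr_apply]
        by_cases hk : k ∈ E j
        · simp [hk]
        · have : k ∉ x.support := by
            rw [← he]; simp [restr_apply, hk]
          simp [Finsupp.notMem_support_iff.mp this]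
    obtain ⟨t, ht1, ht⟩ : ∃ t : ℝ, t < 1 ∧ ∀ i, S.theta i ≤ t := by
      rcases isEmpty_or_nonempty I with hI | hI
      · exact ⟨0, one_pos, fun i => hI.elim i⟩
      · obtain ⟨i, hi⟩ := Finite.exists_max S.theta
        exact ⟨S.theta i, S.theta_lt_one i, hi⟩
    have hub : N x ≤ max (P x) (t * N x) := by
      refine (hN x).2 ?_
      rintro e (rfl | he)
      · exact le_max_of_le_left ((hP x).1 (Set.mem_insert _ _))
      · rcases key e he with h | ⟨i, rfl⟩
        · exact le_max_of_le_left h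
        · exact le_max_of_le_right (mul_le_mul_of_nonneg_right (ht i) hNpos.le)
    rcases le_max_iff.mp hub with h | h
    · exact absurd h (not_le.mpr hlt)
    · nlinarith

/-- For finitely many pairs, the norm is the only solution of the implicit equation that
vanishes at `0`. -/
theorem tnorm_unique [Finite I] {N : (ℕ →₀ ℝ) → ℝ} (hN0 : N 0 = 0)
    (hN : ∀ x, IsLUB (insert (supNorm x) (admValues S N x)) (N x)) (x : ℕ →₀ ℝ) :
    N x = tnorm S x :=
  le_antisymm (solution_le S hN0 hN (isLUB_tnorm S) _ x rfl)
    (solution_le S (tnorm_zero S) (isLUB_tnorm S) hN _ x rfl)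

end

/-! ### Mixed Tsirelson spaces -/

/-- The space `c₀₀`, to be equipped with the mixed Tsirelson norm of `S`. -/
def CZeroZero {I : Type} (_S : PairSeq I) : Type := ℕ →₀ ℝ

variable {I : Type} (S : PairSeq I)

instance : AddCommGroup (CZeroZero S) := inferInstanceAs (AddCommGroup (ℕ →₀ ℝ))

instance : Module ℝ (CZeroZero S) := inferInstanceAs (Module ℝ (ℕ →₀ ℝ))

instance : Norm (CZeroZero S) := ⟨fun x => tnorm S x⟩

theorem czeroCore : NormedSpace.Core ℝ (CZeroZero S) where
  norm_nonneg x := tnorm_nonneg S x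
  norm_smul c x := tnorm_smul S c x
  norm_triangle x y := tnorm_add S x y
  norm_eq_zero_iff x := ⟨fun h => eq_zero_of_tnorm S h, fun h => by
    rw [h]; exact tnorm_zero S⟩

instance : NormedAddCommGroup (CZeroZero S) := NormedAddCommGroup.ofCore (czeroCore S)

instance : NormedSpace ℝ (CZeroZero S) := NormedSpace.ofCore (czeroCore S)

/-- The mixed Tsirelson space `T[(F_i, θ_i)_{i ∈ I}]`: the completion of `c₀₀` for the mixed
Tsirelson norm. -/
abbrev PairSeq.Space : Type := UniformSpace.Completion (CZeroZero S)

/-- The natural basis `(e_n)` of the mixed Tsirelson space. -/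
def PairSeq.basis (n : ℕ) : S.Space :=
  UniformSpace.Completion.coe' (show CZeroZero S from Finsupp.single n (1 : ℝ))

/-- Two sequences `(x_j)` and `(y_j)` of vectors of normed spaces, with the same index set, are
equivalent: there is `C ≥ 1` such that
`C⁻¹ ‖∑ a_j y_j‖ ≤ ‖∑ a_j x_j‖ ≤ C ‖∑ a_j y_j‖` for all finitely supported scalars `(a_j)`. -/
def SeqEquivalent {J X Y : Type} [NormedAddCommGroup X] [NormedSpace ℝ X]
    [NormedAddCommGroup Y] [NormedSpace ℝ Y] (x : J → X) (y : J → Y) : Prop :=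
  ∃ C : ℝ, 1 ≤ C ∧ ∀ a : J →₀ ℝ,
    C⁻¹ * ‖a.sum fun j c => c • y j‖ ≤ ‖a.sum fun j c => c • x j‖ ∧
      ‖a.sum fun j c => c • x j‖ ≤ C * ‖a.sum fun j c => c • y j‖

end Tsirelson

end

noncomputable section

namespace Tsirelson

/-! ### Derivatives of regular families -/

/-! The one-family norm is at most the mixed norm, so only the upper estimate needs work. Put κ =
ω^(ω^δ) with δ = λ(λ(ι(B_{i₀}))), let k = n(ι(B_{i₀})) and τ = θ_{i₀}^(1/k). Then κ^k ≤ ι(B_{i₀}),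
and the comparison gives for every i some p_i with ι(B_i) < κ^(p_i+1) and θ_i ≤ τ^(p_i)
(`TLe.exists_lt_pow`). Thus τ is the price of one factor κ.

Families are replaced by ordinals. The ranks of the initial segments of a witness of admissibility
decrease strictly, so an admissible sequence carries decreasing ordinal labels, finitely many being
possible at each integer (`IsAdmissible.sum_le_labelledSup`). Nesting labelled sums multiplies the
bounds on the labels (`labelledSup_labelledSup_le`), and ordinal division undoes the nesting
(`labelledSup_le_of_div_mod`). Hence a B_i-sum is at most a sum of order η < κ over p_i nested sums
of order κ (`labelledSup_pow_mul_le`). Conversely, on a sparse set B_{i₀} absorbs sums of order κ^k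
at the price θ_{i₀} = τ^k (`exists_theta_mul_labelledSup_le`).

In `mul_stage_le` the mixed norm is unfolded: each layer of order κ is paid for by τ, and k layers
are absorbed together. A family with p_i = 0 yields a sum of order η and only a factor at most q =
max θ_i. Since η^L κ = κ, up to L such sums hide inside a layer of order κ, and L factors with q^L ≤
τ buy a new layer. The state of this bookkeeping is bounded, so the constant does not depend on the
depth of the unfolding. -/

lemma mem_cbDerivative {G : Set (Finset ℕ)} {s : Finset ℕ} :
    s ∈ cbDerivative G ↔ ∀ K, ∃ u ∈ G, u ≠ s ∧ ∀ i < K, (i ∈ u ↔ i ∈ s) := by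
  have key : ∀ u K, charFun u ∈ PiNat.cylinder (charFun s) K ↔ ∀ i < K, (i ∈ u ↔ i ∈ s) := by
    intro u K
    simp [PiNat.mem_cylinder_iff, charFun]
  unfold cbDerivative
  rw [Set.mem_ofPred_eq, accPt_iff_nhds]
  constructor
  · intro h K
    obtain ⟨y, ⟨hy1, u, hu, rfl⟩, hne⟩ := h (PiNat.cylinder (charFun s) K)
      ((PiNat.isOpen_cylinder (fun _ : ℕ => Bool) _ _).mem_nhds (PiNat.self_mem_cylinder _ _))
    exact ⟨u, hu, fun h => hne (by rw [h]), (key u K).1 hy1⟩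
  · intro h U hU
    obtain ⟨V, ⟨y, K, rfl⟩, hV, hVU⟩ :=
      (PiNat.isTopologicalBasis_cylinders (fun _ : ℕ => Bool)).mem_nhds_iff.1 hU
    obtain ⟨u, hu, hne, hi⟩ := h K
    refine ⟨charFun u, ⟨hVU ?_, u, hu, rfl⟩, fun h => hne ?_⟩
    · rw [PiNat.mem_cylinder_iff_eq] at hV
      rw [← hV]
      exact (key u K).2 hi
    · ext i
      have := congrFun h i
      simpa [charFun] using this

lemma mem_cbIter {F : Set (Finset ℕ)} {α : Ordinal.{0}} {s : Finset ℕ} :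
    s ∈ cbIter F α ↔ s ∈ F ∧ ∀ β < α, s ∈ cbDerivative (cbIter F β) := by
  rw [cbIter]; rfl

lemma cbIter_anti {F : Set (Finset ℕ)} {α β : Ordinal.{0}} (h : β ≤ α) :
    cbIter F α ⊆ cbIter F β := by
  intro s hs
  rw [mem_cbIter] at hs ⊢
  exact ⟨hs.1, fun γ hγ => hs.2 γ (hγ.trans_le h)⟩

lemma cbIter_subset {F : Set (Finset ℕ)} {α : Ordinal.{0}} : cbIter F α ⊆ F :=
  fun _ hs => (mem_cbIter.1 hs).1

/-- A set `u` close to `t` becomes close to `s` after deleting `t \ s`, and it stays different from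
`s` because its points beyond `t` survive. -/
lemma IsHereditary.cbIter {F : Set (Finset ℕ)} (hF : IsHereditary F) (α : Ordinal.{0}) :
    IsHereditary (cbIter F α) := by
  induction α using WellFoundedLT.induction with
  | _ α ih =>
    intro t ht s hst
    rw [mem_cbIter] at ht ⊢
    refine ⟨hF t ht.1 s hst, fun β hβ => mem_cbDerivative.2 fun K => ?_⟩
    obtain ⟨u, hu, hne, hi⟩ := mem_cbDerivative.1 (ht.2 β hβ) (max K (t.sup id + 1))
    have hlt : ∀ x ∈ t, x < t.sup id + 1 := fun x hx =>
      Nat.lt_succ_of_le (Finset.le_sup (f := id) hx)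
    have htu : t ⊆ u := fun x hx => (hi x (lt_max_of_lt_right (hlt x hx))).2 hx
    refine ⟨u \ (t \ s), ih β hβ u hu _ Finset.sdiff_subset, fun h => hne ?_, fun i hiK => ?_⟩
    · refine Finset.Subset.antisymm (fun x hx => ?_) htu
      by_contra hxt
      have : x ∈ u \ (t \ s) := by simp [hx, hxt]
      rw [h] at this
      exact hxt (hst this)
    · have := hi i (lt_max_of_lt_left hiK)
      simp only [Finset.mem_sdiff, this]
      constructor
      · rintro ⟨h1, h2⟩
        by_contra h3
        exact h2 ⟨h1, h3⟩
      · exact fun h => ⟨hst h, fun h' => h'.2 h⟩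

/-- The images of the members of `F` under increasing maps that move no point to the left belong
to `F`. -/
def IsShiftClosed (F : Set (Finset ℕ)) : Prop :=
  ∀ s ∈ F, ∀ g : ℕ → ℕ, StrictMonoOn g s → (∀ x ∈ s, x ≤ g x) → s.image g ∈ F

lemma IsSpreading.isShiftClosed {F : Set (Finset ℕ)} (hF : IsSpreading F) : IsShiftClosed F := by
  intro s hs g hg hle
  have hcard : (s.image g).card = s.card := Finset.card_image_of_injOn hg.injOn
  refine hF s hs _ ⟨hcard, fun i => ?_⟩
  have := Finset.orderEmbOfFin_unique hcard (f := fun i => g (s.orderEmbOfFin rfl i))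
    (fun i => Finset.mem_image_of_mem _ (Finset.orderEmbOfFin_mem _ _ _))
    (fun i j hij => hg (Finset.orderEmbOfFin_mem _ _ _) (Finset.orderEmbOfFin_mem _ _ _)
      ((s.orderEmbOfFin rfl).strictMono hij))
  rw [← congrFun this i]
  exact hle _ (Finset.orderEmbOfFin_mem _ _ _)

lemma IsShiftClosed.cbIter {F : Set (Finset ℕ)} (hF : IsShiftClosed F) (α : Ordinal.{0}) :
    IsShiftClosed (cbIter F α) := by
  induction α using WellFoundedLT.induction with
  | _ α ih =>
    intro s hs g hg hle
    rw [mem_cbIter] at hs ⊢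
    refine ⟨hF s hs.1 g hg hle, fun β hβ => mem_cbDerivative.2 fun K => ?_⟩
    -- `g` is extended by the identity off `s`. The points of `u` outside `s` are at least `B`,
    -- hence beyond `s` and its image and outside the window below `K`.
    set B := max K (max (s.sup id) (s.sup g) + 1) with hB
    have hlt : ∀ x ∈ s, x < B ∧ g x < B := by
      intro x hx
      have h1 := Finset.le_sup (f := id) hx
      have h2 := Finset.le_sup (f := g) hx
      simp only [id] at h1
      omega
    obtain ⟨u, hu, hne, hi⟩ := mem_cbDerivative.1 (hs.2 β hβ) B
    have hsu : s ⊆ u := fun x hx => (hi x (hlt x hx).1).2 hx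
    have hbig : ∀ x ∈ u, x ∉ s → B ≤ x := by
      intro x hx hxs
      by_contra hlt
      exact hxs ((hi x (not_le.1 hlt)).1 hx)
    refine ⟨u.image fun x => if x ∈ s then g x else x, ih β hβ u hu _ ?_ ?_, ?_, ?_⟩
    · intro x hx y hy hxy
      dsimp only
      split_ifs with h1 h2 h2
      · exact hg h1 h2 hxy
      · exact (hlt x h1).2.trans_le (hbig y hy h2)
      · have := hbig x hx h1
        have := (hlt y h2).1
        omega
      · exact hxy
    · intro x hx
      split_ifs with h1
      · exact hle x h1
      · exact le_rfl
    · intro h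
      apply hne
      refine Finset.Subset.antisymm (fun x hx => ?_) hsu
      by_contra hxs
      have h1 : x ∈ u.image fun x => if x ∈ s then g x else x :=
        Finset.mem_image.2 ⟨x, hx, by simp [hxs]⟩
      rw [h] at h1
      obtain ⟨y, hy, rfl⟩ := Finset.mem_image.1 h1
      have := (hlt y hy).2
      have := hbig _ hx hxs
      omega
    · intro i hiK
      have hiB : i < B := hiK.trans_le (le_max_left _ _)
      simp only [Finset.mem_image]
      constructor
      · rintro ⟨x, hx, hxi⟩
        split_ifs at hxi with h1
        · exact ⟨x, h1, hxi⟩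
        · have := hbig x hx h1
          omega
      · rintro ⟨x, hx, hxi⟩
        exact ⟨x, hsu hx, by simp [hx, hxi]⟩

/-- A neighbour of `t` in the lower derivative has a point `k` beyond `t`; heredity discards the
other new points, and shifting moves `k` to any larger `n`. -/
lemma eventually_insert_mem_cbIter {F : Set (Finset ℕ)} (hF : IsHereditary F)
    (hS : IsShiftClosed F) {t : Finset ℕ} {β γ : Ordinal.{0}} (ht : t ∈ cbIter F γ) (h : β < γ) :
    ∀ᶠ n in Filter.atTop, insert n t ∈ cbIter F β := by
  obtain ⟨u, hu, hne, hi⟩ := mem_cbDerivative.1 ((mem_cbIter.1 ht).2 β h) (t.sup id + 1)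
  have hlt : ∀ x ∈ t, x < t.sup id + 1 := fun x hx =>
    Nat.lt_succ_of_le (Finset.le_sup (f := id) hx)
  have htu : t ⊆ u := fun x hx => (hi x (hlt x hx)).2 hx
  obtain ⟨k, hku, hkt⟩ : ∃ k ∈ u, k ∉ t := by
    by_contra hcon
    push Not at hcon
    exact hne (Finset.Subset.antisymm hcon htu)
  have hk : ∀ x ∈ t, x < k := by
    intro x hx
    by_contra hlt'
    exact hkt ((hi k (by have := hlt x hx; omega)).1 hku)
  have hmem : insert k t ∈ cbIter F β :=
    hF.cbIter β u hu _ (Finset.insert_subset hku htu)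
  filter_upwards [Filter.eventually_ge_atTop k] with n hn
  have := hS.cbIter β _ hmem (fun x => if x = k then n else x) ?_ ?_
  · rw [Finset.image_insert] at this
    simp only [if_true] at this
    rwa [Finset.image_congr (g := id) (fun x hx => by
      simp [(hk x hx).ne]), Finset.image_id] at this
  · intro x hx y hy hxy
    simp only [Finset.coe_insert, Set.mem_insert_iff, Finset.mem_coe] at hx hy
    dsimp only
    split_ifs with h1 h2 h2
    · omega
    · rcases hy with hy | hy
      · omega
      · have := hk y hy; omega
    · omega
    · omega
  · intro x _
    split_ifs with h1 <;> omega

/-! ### The Cantor-Bendixson index and ranks of finite sets -/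

/-- At the supremum of the ranks of all finite sets the derivative is stable, so it has no isolated
points. If it were nonempty, its closure would put a copy of the Cantor space into the countable
closed set given by `F`. -/
lemma exists_cbIter_subset {F : Set (Finset ℕ)} (hF : IsCompactFamily F) :
    ∃ α, cbIter F α ⊆ {∅} := by
  classical
  by_contra hcon
  push Not at hcon
  let f : Finset ℕ → Ordinal.{0} := fun s => sInf {γ | s ∉ cbIter F γ}
  let α := ⨆ s, f s
  have hstab : cbIter F α ⊆ cbIter F (α + 1) := by
    intro s hs
    by_contra hs'
    have h1 : f s ∈ {γ | s ∉ cbIter F γ} := csInf_mem ⟨α + 1, hs'⟩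
    have h2 : f s ≤ α := le_ciSup (Ordinal.bddAbove_of_small) s
    exact h1 (cbIter_anti h2 hs)
  have hpre : Preperfect (charFun '' cbIter F α) := by
    rintro _ ⟨s, hs, rfl⟩
    exact (mem_cbIter.1 (hstab hs)).2 α (by simp)
  obtain ⟨s, hs, -⟩ := Set.not_subset.1 (hcon α)
  let _ := TopologicalSpace.upgradeIsCompletelyMetrizable (ℕ → Bool)
  obtain ⟨g, hg, -, hinj⟩ := hpre.perfect_closure.exists_nat_bool_injection
    ((Set.Nonempty.image charFun ⟨s, hs⟩).closure)
  have hsub : Set.range g ⊆ charFun '' F :=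
    hg.trans (closure_minimal (Set.image_mono cbIter_subset) hF.isClosed)
  have hc : (Set.range g).Countable := ((Set.to_countable F).image charFun).mono hsub
  have : Countable (ℕ → Bool) := by
    have := hc.to_subtype
    exact (Equiv.ofInjective g hinj).countable_iff.2 this
  have hle := Cardinal.mk_le_aleph0_iff.2 this
  simp only [Cardinal.mk_pi, Cardinal.mk_bool, Cardinal.prod_const, Cardinal.lift_id,
    Cardinal.mk_nat, Cardinal.two_power_aleph0] at hle
  exact Cardinal.aleph0_lt_continuum.not_ge hle

lemma cbIter_cbIndex_subset {F : Set (Finset ℕ)} (hF : IsCompactFamily F) :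
    cbIter F (cbIndex F) ⊆ {∅} :=
  csInf_mem (s := {α | cbIter F α ⊆ {∅}}) (exists_cbIter_subset hF)

lemma empty_mem_cbIter {F : Set (Finset ℕ)} (hF : IsHereditary F) {β : Ordinal.{0}}
    (h : β < cbIndex F) : ∅ ∈ cbIter F β := by
  have h1 : β ∉ {α | cbIter F α ⊆ {∅}} := notMem_of_lt_csInf' h
  obtain ⟨s, hs, -⟩ := Set.not_subset.1 h1
  exact hF.cbIter β s hs _ (Finset.empty_subset s)

/-- The first derivative of `F` that does not contain `s`. -/
def cbRank (F : Set (Finset ℕ)) (s : Finset ℕ) : Ordinal.{0} := sInf {γ | s ∉ cbIter F γ}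

lemma notMem_cbIter_cbRank {F : Set (Finset ℕ)} (hF : IsCompactFamily F) {s : Finset ℕ}
    (hs : s.Nonempty) : s ∉ cbIter F (cbRank F s) :=
  csInf_mem (s := {γ | s ∉ cbIter F γ})
    ⟨cbIndex F, fun h => hs.ne_empty (cbIter_cbIndex_subset hF h)⟩

lemma cbRank_le {F : Set (Finset ℕ)} (hF : IsCompactFamily F) {s : Finset ℕ}
    (hs : s.Nonempty) : cbRank F s ≤ cbIndex F :=
  csInf_le' fun h => hs.ne_empty (cbIter_cbIndex_subset hF h)

/-- The rank decreases strictly under proper end extensions. -/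
lemma cbRank_lt {F : Set (Finset ℕ)} (hF : IsCompactFamily F) (hH : IsHereditary F)
    (hS : IsShiftClosed F) {s t : Finset ℕ} (hs : s.Nonempty) (ht : t ∈ F) (hst : s ⊆ t)
    (hne : t ≠ s) (hend : ∀ x ∈ s, ∀ y ∈ t, y ∉ s → x < y) : cbRank F t < cbRank F s := by
  -- Otherwise `t` lies in every derivative below the rank of `s`. Translating `t \ s` to the right
  -- keeps it there and gives sets converging to `s`, so `s` would lie in the derivative that
  -- defines its rank.
  by_contra! hle
  refine notMem_cbIter_cbRank hF hs (cbIter_anti hle (mem_cbIter.2 ⟨hH t ht s hst, ?_⟩))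
  intro β hβ
  have htβ : t ∈ cbIter F β := by
    by_contra hcon
    exact notMem_of_lt_csInf' (s := {γ | t ∉ cbIter F γ}) hβ hcon
  refine mem_cbDerivative.2 fun K =>
    ⟨t.image fun x => if x ∈ s then x else x + K, hS.cbIter β t htβ _ ?_ ?_, ?_, ?_⟩
  · intro x hx y hy hxy
    dsimp only
    split_ifs with h1 h2 h2
    · exact hxy
    · omega
    · have := hend y h2 x hx h1
      omega
    · omega
  · intro x _
    split_ifs <;> omega
  · intro h
    have hc := congrArg Finset.card h
    rw [Finset.card_image_of_injOn] at hc
    · exact hne (Finset.eq_of_subset_of_card_le hst hc.le).symm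
    · intro x hx y hy hxy
      dsimp only at hxy
      split_ifs at hxy with h1 h2 h2
      · exact hxy
      · have := hend x h1 y hy h2
        omega
      · have := hend y h2 x hx h1
        omega
      · omega
  · intro i hi
    simp only [Finset.mem_image]
    constructor
    · rintro ⟨x, hx, hxi⟩
      split_ifs at hxi with h1
      · exact hxi ▸ h1
      · omega
    · exact fun h => ⟨i, hst h, by simp [h]⟩

/-! ### Sums along sequences of sets labelled by decreasing ordinals -/

/-- `c` is a sum `∑_j V (E_j)` over nonempty sets `E_1 < E_2 < ...` contained in `E` that carry
labels `a > v_1 > v_2 > ...` with `v_j ∈ lab k` for all `k ∈ E_j`. -/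
inductive LabelledSum (lab : ℕ → Set Ordinal.{0}) (V : Finset ℕ → ℝ) :
    Ordinal.{0} → Finset ℕ → ℝ → Prop
  | nil (a : Ordinal.{0}) (E : Finset ℕ) : LabelledSum lab V a E 0
  | cons {a v : Ordinal.{0}} {E E₁ E₂ : Finset ℕ} {c : ℝ} : v < a → (∀ k ∈ E₁, v ∈ lab k) →
      E₁.Nonempty → E₁ ⊆ E → E₂ ⊆ E → (∀ i ∈ E₁, ∀ j ∈ E₂, i < j) →
      LabelledSum lab V v E₂ c → LabelledSum lab V a E (V E₁ + c)

/-- The supremum of the sums `∑_j V (E_j)` along labelled sequences of subsets of `E`. -/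
def labelledSup (lab : ℕ → Set Ordinal.{0}) (a : Ordinal.{0}) (V : Finset ℕ → ℝ)
    (E : Finset ℕ) : ℝ := sSup {c | LabelledSum lab V a E c}

section

variable {lab labA labW : ℕ → Set Ordinal.{0}} {a b w : Ordinal.{0}} {V W : Finset ℕ → ℝ}
  {E E' : Finset ℕ} {c : ℝ}

lemma LabelledSum.mono (h : LabelledSum lab V a E c) (ha : a ≤ b) (hE : E ⊆ E') :
    LabelledSum lab V b E' c := by
  cases h with
  | nil => exact .nil _ _
  | cons h1 h2 h3 h4 h5 h6 h7 => exact .cons (h1.trans_le ha) h2 h3 (h4.trans hE) (h5.trans hE) h6 h7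

lemma LabelledSum.le_card_mul (h : LabelledSum lab V a E c) {B : ℝ} (hB0 : 0 ≤ B)
    (hB : ∀ F ⊆ E, V F ≤ B) : c ≤ E.card * B := by
  induction h with
  | nil a E => positivity
  | @cons a v E E₁ E₂ c h1 h2 h3 h4 h5 h6 h7 ih =>
    have hd : Disjoint E₁ E₂ := Finset.disjoint_left.2 fun x h1 h2 => (h6 x h1 x h2).false
    have hcard : 1 + E₂.card ≤ E.card := by
      have := Finset.card_le_card (Finset.union_subset h4 h5)
      rw [Finset.card_union_of_disjoint hd] at this
      have := h3.card_pos
      omega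
    calc V E₁ + c ≤ B + E₂.card * B :=
          add_le_add (hB _ h4) (ih fun F hF => hB F (hF.trans h5))
      _ = ((1 + E₂.card : ℕ) : ℝ) * B := by push_cast; ring
      _ ≤ E.card * B := by
          apply mul_le_mul_of_nonneg_right _ hB0
          exact_mod_cast hcard

lemma bddAbove_labelledSum (lab : ℕ → Set Ordinal.{0}) (a : Ordinal.{0}) (V : Finset ℕ → ℝ)
    (E : Finset ℕ) : BddAbove {c | LabelledSum lab V a E c} := by
  refine ⟨E.card * ∑ F ∈ E.powerset, |V F|, fun c hc =>
    LabelledSum.le_card_mul hc (Finset.sum_nonneg fun _ _ => abs_nonneg _) fun F hF => ?_⟩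
  exact (le_abs_self _).trans (Finset.single_le_sum (f := fun F => |V F|)
    (fun _ _ => abs_nonneg _) (Finset.mem_powerset.2 hF))

lemma LabelledSum.le_labelledSup (h : LabelledSum lab V a E c) : c ≤ labelledSup lab a V E :=
  le_csSup (bddAbove_labelledSum lab a V E) h

lemma labelledSup_le {u : ℝ} (h : ∀ c, LabelledSum lab V a E c → c ≤ u) :
    labelledSup lab a V E ≤ u :=
  csSup_le ⟨0, .nil _ _⟩ h

lemma labelledSup_nonneg : 0 ≤ labelledSup lab a V E := (LabelledSum.nil a E).le_labelledSup

lemma labelledSup_empty : labelledSup lab a V ∅ = 0 := by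
  refine le_antisymm (labelledSup_le fun c hc => ?_) labelledSup_nonneg
  cases hc with
  | nil => exact le_rfl
  | cons _ _ h3 h4 => exact absurd (Finset.subset_empty.1 h4) h3.ne_empty

lemma mul_labelledSup_le {t : ℝ} (ht : 0 ≤ t) (h : ∀ F ⊆ E, t * V F ≤ W F) :
    t * labelledSup lab a V E ≤ labelledSup lab a W E := by
  have key : ∀ a E c, LabelledSum lab V a E c → (∀ F ⊆ E, t * V F ≤ W F) →
      t * c ≤ labelledSup lab a W E := by
    intro a E c hc
    induction hc with
    | nil a E => intro _; simpa using labelledSup_nonneg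
    | @cons a v E E₁ E₂ c h1 h2 h3 h4 h5 h6 h7 ih =>
      intro h
      have h8 := ih fun F hF => h F (hF.trans h5)
      have h9 : labelledSup lab v W E₂ ≤ labelledSup lab a W E - W E₁ := by
        refine labelledSup_le fun c' hc' => ?_
        have := (LabelledSum.cons h1 h2 h3 h4 h5 h6 hc').le_labelledSup
        linarith
      have := h _ h4
      rw [mul_add]
      linarith
  rcases ht.eq_or_lt with rfl | ht'
  · simpa using labelledSup_nonneg
  · rw [mul_comm, ← le_div_iff₀ ht']
    refine labelledSup_le fun c hc => ?_
    rw [le_div_iff₀ ht', mul_comm]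
    exact key _ _ _ hc h

lemma labelledSup_le_labelledSup (h : ∀ F ⊆ E, V F ≤ W F) :
    labelledSup lab a V E ≤ labelledSup lab a W E := by
  simpa using mul_labelledSup_le (lab := lab) (a := a) zero_le_one (V := V) (W := W) (by simpa using h)

/-- A one-term sequence with label `0` suffices. This is what allows unused layers to be inserted
later. -/
lemma le_labelledSup (ha : 0 < a) (h0 : ∀ n, 0 ∈ lab n) (hV : V ∅ = 0) (E : Finset ℕ) :
    V E ≤ labelledSup lab a V E := by
  rcases E.eq_empty_or_nonempty with rfl | hE
  · rw [hV]; exact labelledSup_nonneg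
  · have := LabelledSum.cons (lab := lab) (V := V) ha (fun k _ => h0 k) hE subset_rfl
      (Finset.empty_subset E) (by simp) (.nil 0 ∅)
    simpa using this.le_labelledSup

/-- Labels for sequences that are the concatenation of sequences with labels in `labW`, themselves
labelled in `labA`. -/
def compLab (labA : ℕ → Set Ordinal.{0}) (b : Ordinal.{0}) (labW : ℕ → Set Ordinal.{0}) (n : ℕ) :
    Set Ordinal.{0} := Set.image2 (fun v w => b * v + w) (labA n) (labW n)

/-- The labels `b * v + w` are ordered lexicographically: `w` decreases within a block, and the next
block has labels below `b * v`. -/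
lemma LabelledSum.append_comp {v : Ordinal.{0}} {E₁ E₂ : Finset ℕ} {c₁ c₂ : ℝ}
    (h₁ : LabelledSum labW V w E₁ c₁) (hv : ∀ k ∈ E₁, v ∈ labA k)
    (h₂ : LabelledSum (compLab labA b labW) V (b * v) E₂ c₂)
    (hlt : ∀ i ∈ E₁, ∀ j ∈ E₂, i < j) :
    LabelledSum (compLab labA b labW) V (b * v + w) (E₁ ∪ E₂) (c₁ + c₂) := by
  induction h₁ with
  | nil a E =>
    rw [zero_add]
    exact h₂.mono le_self_add Finset.subset_union_right
  | @cons a w' E F₁ F₂ c h1 h2 h3 h4 h5 h6 h7 ih =>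
    rw [add_assoc]
    refine .cons (v := b * v + w') (E₂ := F₂ ∪ E₂) (by gcongr)
      (fun k hk => ⟨v, hv k (h4 hk), w', h2 k hk, rfl⟩) h3
      (h4.trans Finset.subset_union_left) (Finset.union_subset_union_left h5) ?_
      (ih (fun k hk => hv k (h5 hk)) fun i hi j hj => hlt i (h5 hi) j hj)
    intro i hi j hj
    rcases Finset.mem_union.1 hj with hj | hj
    · exact h6 i hi j hj
    · exact hlt i (h4 hi) j hj

/-- A block with outer label `v` uses labels between `b * v` and `b * v + b`, and the latter is at
most `b * a` when `v < a`. -/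
lemma labelledSup_labelledSup_le :
    labelledSup labA a (labelledSup labW b V) E ≤
      labelledSup (compLab labA b labW) (b * a) V E := by
  refine labelledSup_le fun c hc => ?_
  induction hc with
  | nil a E => exact labelledSup_nonneg
  | @cons a v E E₁ E₂ c h1 h2 h3 h4 h5 h6 h7 ih =>
    have h8 : ∀ c₁, LabelledSum labW V b E₁ c₁ →
        c₁ + c ≤ labelledSup (compLab labA b labW) (b * a) V E := by
      intro c₁ hc₁
      have h9 : labelledSup (compLab labA b labW) (b * v) V E₂ ≤
          labelledSup (compLab labA b labW) (b * a) V E - c₁ := by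
        refine labelledSup_le fun c₂ hc₂ => ?_
        have h10 := hc₁.append_comp h2 hc₂ h6
        have h11 : b * v + b ≤ b * a := by
          rw [← mul_add_one]
          gcongr
          exact Order.add_one_le_of_lt h1
        have := (h10.mono h11 (Finset.union_subset h4 h5)).le_labelledSup
        linarith
      linarith
    have : labelledSup labW b V E₁ ≤ labelledSup (compLab labA b labW) (b * a) V E - c :=
      labelledSup_le fun c₁ hc₁ => by have := h8 c₁ hc₁; linarith
    linarith

/-- Consecutive sets whose labels have the same quotient by `b` form one group. The group with
quotient `a` may already be open on the left, so its remaining part `E₀` is returned separately,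
with remainders below `w`. Monotonicity of `labA` makes the label of the first set of a group
available at all later points of the group. -/
lemma LabelledSum.regroup (hmono : Monotone labA) (hb : b ≠ 0)
    (hlab : ∀ n, ∀ u ∈ lab n, u / b ∈ labA n ∧ u % b ∈ labW n) {t : Ordinal.{0}}
    (h : LabelledSum lab V t E c) : ∀ a w, w ≤ b → t ≤ b * a + w →
    ∃ E₀ E₁ c₀ c₁, E₀ ⊆ E ∧ E₁ ⊆ E ∧ (∀ i ∈ E₀, ∀ j ∈ E₁, i < j) ∧ LabelledSum labW V w E₀ c₀ ∧
      LabelledSum labA (labelledSup labW b V) a E₁ c₁ ∧ c ≤ c₀ + c₁ := by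
  induction h with
  | nil t E =>
    exact fun a w _ _ => ⟨∅, ∅, 0, 0, by simp, by simp, by simp, .nil _ _, .nil _ _, by simp⟩
  | @cons t u E F₁ F₂ c h1 h2 h3 h4 h5 h6 h7 ih =>
    intro a w hw ht
    obtain ⟨E₀, E₁, c₀, c₁, g1, g2, g3, g4, g5, g6⟩ :=
      ih (u / b) (u % b) (Ordinal.mod_lt u hb).le (Ordinal.div_add_mod u b).ge
    have hu : u < b * a + w := h1.trans_le ht
    have hua : u / b ≤ a := by
      rw [Ordinal.div_le hb, Order.succ_eq_add_one, mul_add_one]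
      exact hu.trans_le (by gcongr)
    have hd : ∀ i ∈ F₁, ∀ j ∈ E₀, i < j := fun i hi j hj => h6 i hi j (g1 hj)
    rcases hua.eq_or_lt with heq | hlt
    · have huw : u % b < w := by
        rw [← Ordinal.div_add_mod u b, heq] at hu
        exact lt_of_add_lt_add_left hu
      refine ⟨F₁ ∪ E₀, E₁, V F₁ + c₀, c₁, Finset.union_subset h4 (g1.trans h5), g2.trans h5, ?_,
        .cons huw (fun k hk => (hlab k u (h2 k hk)).2) h3 Finset.subset_union_left
          Finset.subset_union_right hd g4, heq ▸ g5, by linarith⟩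
      intro i hi j hj
      rcases Finset.mem_union.1 hi with hi | hi
      · exact h6 i hi j (g2 hj)
      · exact g3 i hi j hj
    · have hgrp : LabelledSum labW V b (F₁ ∪ E₀) (V F₁ + c₀) :=
        .cons (Ordinal.mod_lt u hb) (fun k hk => (hlab k u (h2 k hk)).2) h3
          Finset.subset_union_left Finset.subset_union_right hd g4
      refine ⟨∅, F₁ ∪ E₀ ∪ E₁, 0, labelledSup labW b V (F₁ ∪ E₀) + c₁, by simp, ?_, by simp,
        .nil _ _, .cons hlt ?_ (h3.mono Finset.subset_union_left) Finset.subset_union_left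
          Finset.subset_union_right ?_ g5, ?_⟩
      · exact Finset.union_subset (Finset.union_subset h4 (g1.trans h5)) (g2.trans h5)
      · intro k hk
        rcases Finset.mem_union.1 hk with hk | hk
        · exact (hlab k u (h2 k hk)).1
        · obtain ⟨i, hi⟩ := h3
          exact hmono (hd i hi k hk).le (hlab i u (h2 i hi)).1
      · intro i hi j hj
        rcases Finset.mem_union.1 hi with hi | hi
        · exact h6 i hi j (g2 hj)
        · exact g3 i hi j hj
      · have := hgrp.le_labelledSup
        linarith

lemma labelledSup_le_of_div_mod (hmono : Monotone labA) (hb : b ≠ 0)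
    (hlab : ∀ n, ∀ u ∈ lab n, u / b ∈ labA n ∧ u % b ∈ labW n) :
    labelledSup lab (b * a) V E ≤ labelledSup labA a (labelledSup labW b V) E := by
  refine labelledSup_le fun c hc => ?_
  obtain ⟨E₀, E₁, c₀, c₁, -, g2, -, g4, g5, g6⟩ :=
    hc.regroup hmono hb hlab a 0 zero_le (by simp)
  have h0 : c₀ = 0 := by
    cases g4 with
    | nil => rfl
    | cons h => exact absurd h not_lt_zero
  have := (g5.mono le_rfl g2).le_labelledSup
  linarith

/-- Empty sets are allowed and skipped, as they will arise from intersecting an admissible sequence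
with `E`. -/
lemma LabelledSum.of_fin {n : ℕ} (G : Fin n → Finset ℕ) (v : Fin n → Ordinal.{0})
    (hV : V ∅ = 0) (hlt : ∀ i j, i < j → ∀ k ∈ G i, ∀ l ∈ G j, k < l)
    (hv : ∀ i j, i < j → v j < v i) (hlab : ∀ j, ∀ k ∈ G j, v j ∈ lab k) (ha : ∀ j, v j < a) :
    LabelledSum lab V a (Finset.univ.biUnion G) (∑ j, V (G j)) := by
  induction n generalizing a with
  | zero => simpa using LabelledSum.nil _ _
  | succ n ih =>
    have h1 := ih (fun j => G j.succ) (fun j => v j.succ)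
      (fun i j hij => hlt _ _ (Fin.succ_lt_succ_iff.2 hij))
      (fun i j hij => hv _ _ (Fin.succ_lt_succ_iff.2 hij)) (fun j => hlab j.succ)
      (a := v 0) (fun j => hv _ _ (Fin.succ_pos j))
    have hsub : Finset.univ.biUnion (fun j : Fin n => G j.succ) ⊆ Finset.univ.biUnion G := by
      intro x hx
      simp only [Finset.mem_biUnion, Finset.mem_univ, true_and] at hx ⊢
      obtain ⟨j, hj⟩ := hx
      exact ⟨_, hj⟩
    rw [Fin.sum_univ_succ]
    rcases (G 0).eq_empty_or_nonempty with h0 | h0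
    · rw [h0, hV, zero_add]
      exact h1.mono (ha 0).le hsub
    · refine .cons (ha 0) (hlab 0) h0 (Finset.subset_biUnion_of_mem G (Finset.mem_univ 0)) hsub ?_ h1
      intro i hi j hj
      simp only [Finset.mem_biUnion, Finset.mem_univ, true_and] at hj
      obtain ⟨l, hl⟩ := hj
      exact hlt _ _ (Fin.succ_pos l) i hi j hl

end

/-! ### Lower estimates for the norm of a single family -/

lemma restr_restr (E E' : Finset ℕ) (x : ℕ →₀ ℝ) : restr E (restr E' x) = restr (E ∩ E') x := by
  ext n
  by_cases h1 : n ∈ E <;> by_cases h2 : n ∈ E' <;> simp [restr_apply, h1, h2]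

lemma restr_empty (x : ℕ →₀ ℝ) : restr ∅ x = 0 := by
  ext n
  simp [restr_apply]

section

variable {I : Type} (S : PairSeq I) (x : ℕ →₀ ℝ)

lemma stage_zero (k : ℕ) : stage S k 0 = 0 := by
  refine le_antisymm ?_ (stage_nonneg S k 0)
  simpa using stage_smul_le S k 0 0

lemma stage_restr_le (k : ℕ) (E : Finset ℕ) : ∀ x, stage S k (restr E x) ≤ stage S k x := by
  have hsup : ∀ x, supNorm (restr E x) ≤ supNorm x := fun x => ciSup_le fun n => by
    rw [restr_apply]
    split_ifs
    · exact abs_le_supNorm x n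
    · simpa using supNorm_nonneg x
  induction k with
  | zero => exact hsup
  | succ k ih =>
    intro x
    refine stage_succ_le S ((hsup x).trans (supNorm_le_stage S _ x)) ?_
    rintro _ ⟨i, n, G, hG, rfl⟩
    refine le_trans ?_ (le_stage_succ S k x ⟨i, n, G, hG, rfl⟩)
    refine mul_le_mul_of_nonneg_left (Finset.sum_le_sum fun j _ => ?_) (S.theta_pos i).le
    rw [restr_restr, Finset.inter_comm, ← restr_restr]
    exact ih _

lemma stage_restr_mono (k : ℕ) {E E' : Finset ℕ} (h : E ⊆ E') :
    stage S k (restr E x) ≤ stage S k (restr E' x) := by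
  rw [← Finset.inter_eq_left.2 h, ← restr_restr]
  exact stage_restr_le S k E _

lemma tnorm_restr_mono {E E' : Finset ℕ} (h : E ⊆ E') :
    tnorm S (restr E x) ≤ tnorm S (restr E' x) :=
  ciSup_le fun k => (stage_restr_mono S x k h).trans (stage_le_tnorm S k _)

lemma abs_le_tnorm_restr {E : Finset ℕ} {n : ℕ} (hn : n ∈ E) : |x n| ≤ tnorm S (restr E x) := by
  have := (abs_le_supNorm (restr E x) n).trans
    ((supNorm_le_stage S 0 _).trans (stage_le_tnorm S 0 _))
  rwa [restr_apply, if_pos hn] at this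

/-- The largest of the numbers `|x n| + ‖(E ∩ (n, ∞)) x‖`, `n ∈ E`. -/
def headNorm (E : Finset ℕ) : ℝ :=
  if h : E.Nonempty then E.sup' h fun n => |x n| + tnorm S (restr (E.filter (n < ·)) x) else 0

lemma headNorm_empty : headNorm S x ∅ = 0 := by simp [headNorm]

lemma le_headNorm {E : Finset ℕ} {n : ℕ} (hn : n ∈ E) :
    |x n| + tnorm S (restr (E.filter (n < ·)) x) ≤ headNorm S x E := by
  rw [headNorm, dif_pos ⟨n, hn⟩]
  exact Finset.le_sup' (fun n => |x n| + tnorm S (restr (E.filter (n < ·)) x)) hn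

lemma exists_headNorm_eq {E : Finset ℕ} (hE : E.Nonempty) :
    ∃ n ∈ E, headNorm S x E = |x n| + tnorm S (restr (E.filter (n < ·)) x) := by
  rw [headNorm, dif_pos hE]
  exact Finset.exists_mem_eq_sup' hE _

lemma headNorm_nonneg (E : Finset ℕ) : 0 ≤ headNorm S x E := by
  rcases E.eq_empty_or_nonempty with rfl | ⟨n, hn⟩
  · exact (headNorm_empty S x).ge
  · exact (add_nonneg (abs_nonneg _) (tnorm_nonneg S _)).trans (le_headNorm S x hn)

lemma headNorm_le (E : Finset ℕ) : headNorm S x E ≤ 2 * tnorm S (restr E x) := by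
  rcases E.eq_empty_or_nonempty with rfl | hE
  · rw [headNorm_empty]
    exact mul_nonneg zero_le_two (tnorm_nonneg S _)
  · obtain ⟨n, hn, h⟩ := exists_headNorm_eq S x hE
    have h1 := abs_le_tnorm_restr S x hn
    have h2 := tnorm_restr_mono S x (Finset.filter_subset (n < ·) E)
    rw [h]
    linarith

lemma supNorm_restr_le_headNorm (E : Finset ℕ) : supNorm (restr E x) ≤ headNorm S x E :=
  ciSup_le fun n => by
    rw [restr_apply]
    split_ifs with h
    · have := le_headNorm S x h
      have := tnorm_nonneg S (restr (E.filter (n < ·)) x)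
      linarith
    · simpa using headNorm_nonneg S x E

end

/-- `c` is at most a sum `∑_j T (G_j)` over subsets `G_j` of `E` such that `(G_j)` is admissible
for `{t | s ∪ t ∈ F}`, witnessed by points that are not to the left of `D`. -/
def BlockSum (F : Set (Finset ℕ)) (T : Finset ℕ → ℝ) (s E D : Finset ℕ) (c : ℝ) : Prop :=
  ∃ (n : ℕ) (G : Fin n → Finset ℕ) (m : Fin n → ℕ), StrictMono m ∧
    s ∪ Finset.univ.image m ∈ F ∧ (∀ j, (G j).Nonempty) ∧ (∀ j, ∀ k ∈ G j, m j ≤ k) ∧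
    (∀ i j, i < j → ∀ k ∈ G i, k < m j) ∧ (∀ j, G j ⊆ E) ∧ (∀ j, ∃ e ∈ D, e ≤ m j) ∧
    c ≤ ∑ j, T (G j)

section

variable {F : Set (Finset ℕ)} {T : Finset ℕ → ℝ} {s E D : Finset ℕ} {c : ℝ}

lemma BlockSum.nil (hs : s ∈ F) : BlockSum F T s E D 0 :=
  ⟨0, Fin.elim0, Fin.elim0, fun i => i.elim0, by simpa using hs, fun i => i.elim0,
    fun i => i.elim0, fun i => i.elim0, fun i => i.elim0, fun i => i.elim0, by simp⟩

/-- `D` is kept apart from `E` because witnesses may lie outside `E`. An empty first set is dropped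
together with its witness `p`, which is where heredity enters. -/
lemma BlockSum.cons (hF : IsHereditary F) (hT : T ∅ = 0) {p : ℕ} {E₀ E₂ D₂ : Finset ℕ}
    (h : BlockSum F T (insert p s) E₂ D₂ c) (h₀ : E₀ ⊆ E) (h₂ : E₂ ⊆ E) (hp : ∃ e ∈ D, e ≤ p)
    (hD : ∀ d ∈ D₂, ∃ e ∈ D, e ≤ d) (hp₀ : ∀ k ∈ E₀, p ≤ k) (hp₂ : ∀ k ∈ D₂, p < k)
    (hlt : ∀ i ∈ E₀, ∀ j ∈ D₂, i < j) : BlockSum F T s E D (T E₀ + c) := by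
  obtain ⟨n, G, m, g1, g2, g3, g4, g5, g6, g7, g8⟩ := h
  rcases E₀.eq_empty_or_nonempty with rfl | hne
  · refine ⟨n, G, m, g1, hF _ g2 _ (Finset.union_subset_union_left (Finset.subset_insert _ _)), g3,
      g4, g5, fun j => (g6 j).trans h₂, fun j => ?_, by rwa [hT, zero_add]⟩
    obtain ⟨d, hd, hdm⟩ := g7 j
    obtain ⟨e, he, hle⟩ := hD d hd
    exact ⟨e, he, hle.trans hdm⟩
  · refine ⟨n + 1, Fin.cons E₀ G, Fin.cons p m, ?_, ?_, ?_, ?_, ?_, ?_, ?_, ?_⟩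
    · intro i j
      refine Fin.cases ?_ (fun i => ?_) i <;> refine Fin.cases ?_ (fun j => ?_) j
      · simp
      · intro _
        obtain ⟨e, he, hle⟩ := g7 j
        simpa using (hp₂ e he).trans_le hle
      · simp
      · simpa using fun h => g1 h
    · convert g2 using 1
      ext y
      simp only [Finset.mem_union, Finset.mem_image, Finset.mem_univ, true_and, Fin.exists_fin_succ,
        Fin.cons_zero, Fin.cons_succ, Finset.mem_insert]
      tauto
    · exact Fin.cases hne g3
    · exact Fin.cases (by simpa using hp₀) (by simpa using g4)
    · intro i j
      refine Fin.cases ?_ (fun i => ?_) i <;> refine Fin.cases ?_ (fun j => ?_) j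
      · simp
      · intro _ k hk
        obtain ⟨e, he, hle⟩ := g7 j
        simpa using (hlt k (by simpa using hk) e he).trans_le hle
      · simp
      · intro hij
        simpa using g5 i j (Fin.succ_lt_succ_iff.1 hij)
    · exact Fin.cases (by simpa using h₀) fun j => by simpa using (g6 j).trans h₂
    · refine Fin.cases (by simpa using hp) fun j => ?_
      obtain ⟨d, hd, hdm⟩ := g7 j
      obtain ⟨e, he, hle⟩ := hD d hd
      exact ⟨e, he, by simpa using hle.trans hdm⟩
    · rw [Fin.sum_univ_succ]
      simpa using g8

end

lemma exists_sparse_subset (f : ℕ → ℕ) {M : Set ℕ} (hM : M.Infinite) :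
    ∃ N ⊆ M, N.Infinite ∧ ∀ a ∈ N, ∀ b ∈ N, a < b → f a ≤ b := by
  choose g hgM hg using fun n => hM.exists_gt n
  let φ : ℕ → ℕ := fun n => Nat.rec (g 0) (fun _ k => g (max k (f k))) n
  have hsucc : ∀ n, φ (n + 1) = g (max (φ n) (f (φ n))) := fun n => rfl
  have hmono : StrictMono φ := strictMono_nat_of_lt_succ fun n => by
    rw [hsucc]
    exact (le_max_left _ _).trans_lt (hg _)
  refine ⟨Set.range φ, ?_, Set.infinite_range_of_injective hmono.injective, ?_⟩
  · rintro _ ⟨n, rfl⟩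
    cases n with
    | zero => exact hgM 0
    | succ n => rw [hsucc]; exact hgM _
  · rintro _ ⟨i, rfl⟩ _ ⟨j, rfl⟩ hij
    have : i + 1 ≤ j := hmono.lt_iff_lt.1 hij
    refine le_trans ?_ (hmono.monotone this)
    rw [hsucc]
    exact ((le_max_right _ _).trans_lt (hg _)).le

/-- A function that bounds how far a member of a derivative has to be extended in order to stay in
lower derivatives. -/
lemma exists_insert_mem_cbIter {F : Set (Finset ℕ)} (hF : IsHereditary F) (hS : IsShiftClosed F)
    (lab : ℕ → Set Ordinal.{0}) (hfin : ∀ n, (lab n).Finite) :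
    ∃ g : ℕ → ℕ, (∀ n, n < g n) ∧ ∀ n, ∀ v ∈ lab n, ∀ t : Finset ℕ, (∀ k ∈ t, k ≤ n) →
      ∀ k ≥ g n, (t ∈ cbIter F (2 * v + 2) → insert k t ∈ cbIter F (2 * v + 1)) ∧
        (t ∈ cbIter F (2 * v + 3) → insert k t ∈ cbIter F (2 * v + 2)) := by
  have key : ∀ n, ∃ K, n < K ∧ ∀ v ∈ lab n, ∀ t ∈ (Finset.range (n + 1)).powerset, ∀ k ≥ K,
      (t ∈ cbIter F (2 * v + 2) → insert k t ∈ cbIter F (2 * v + 1)) ∧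
        (t ∈ cbIter F (2 * v + 3) → insert k t ∈ cbIter F (2 * v + 2)) := by
    intro n
    have h1 : ∀ᶠ k in Filter.atTop, ∀ v ∈ lab n, ∀ t ∈ (Finset.range (n + 1)).powerset,
        (t ∈ cbIter F (2 * v + 2) → insert k t ∈ cbIter F (2 * v + 1)) ∧
          (t ∈ cbIter F (2 * v + 3) → insert k t ∈ cbIter F (2 * v + 2)) := by
      rw [Filter.eventually_all_finite (hfin n)]
      intro v _
      rw [Filter.eventually_all_finset]
      intro t _
      refine Filter.Eventually.and ?_ ?_
      · by_cases ht : t ∈ cbIter F (2 * v + 2)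
        · filter_upwards [eventually_insert_mem_cbIter hF hS ht
            (β := 2 * v + 1) (by gcongr; exact one_lt_two)] with k hk _ using hk
        · exact Filter.Eventually.of_forall fun _ h => absurd h ht
      · by_cases ht : t ∈ cbIter F (2 * v + 3)
        · filter_upwards [eventually_insert_mem_cbIter hF hS ht
            (β := 2 * v + 2) (by gcongr; exact_mod_cast (by norm_num : 2 < 3))] with k hk _ using hk
        · exact Filter.Eventually.of_forall fun _ h => absurd h ht
    obtain ⟨K, hK⟩ := Filter.eventually_atTop.1 h1
    exact ⟨max K (n + 1), by omega, fun v hv t ht k hk => hK k (by omega) v hv t ht⟩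
  choose g hg1 hg2 using key
  refine ⟨g, hg1, fun n v hv t ht k hk => hg2 n v hv t ?_ k hk⟩
  rw [Finset.mem_powerset]
  exact fun i hi => Finset.mem_range.2 (Nat.lt_succ_of_le (ht i hi))

section

variable {I : Type} (S : PairSeq I) (x : ℕ →₀ ℝ)

/-- Each set is split at the point `n` that attains `headNorm`: `{n}` is witnessed by `n`, the tail
by `g n`. Two witnesses per label cost two derivatives, whence `2 * v`. Sparsity puts the later sets
past `g (g n)`, which leaves room for the next extension. -/
lemma LabelledSum.blockSum {F : Set (Finset ℕ)} (hF : IsHereditary F)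
    {lab : ℕ → Set Ordinal.{0}} (hmono : Monotone lab) {g : ℕ → ℕ} (hg : ∀ n, n < g n)
    (hins : ∀ n, ∀ v ∈ lab n, ∀ t : Finset ℕ, (∀ k ∈ t, k ≤ n) →
      ∀ k ≥ g n, (t ∈ cbIter F (2 * v + 2) → insert k t ∈ cbIter F (2 * v + 1)) ∧
        (t ∈ cbIter F (2 * v + 3) → insert k t ∈ cbIter F (2 * v + 2)))
    {N : Set ℕ} (hN : ∀ a ∈ N, ∀ b ∈ N, a < b → g (g a) ≤ b) {v : Ordinal.{0}} {E : Finset ℕ}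
    {c : ℝ} (h : LabelledSum lab (headNorm S x) v E c) : ↑E ⊆ N → ∀ (s : Finset ℕ) (b : ℕ),
    (∀ k ∈ s, k ≤ b) → v ∈ lab b → (∀ k ∈ E, g b ≤ k) → s ∈ cbIter F (2 * v + 2) →
    BlockSum F (fun G => tnorm S (restr G x)) s E E c := by
  have hT : (fun G => tnorm S (restr G x)) ∅ = 0 := by
    simp only [restr_empty, tnorm_zero]
  induction h with
  | nil v E => exact fun _ s b _ _ _ hs => .nil (cbIter_subset hs)
  | @cons v v' E E₁ E₂ c h1 h2 h3 h4 h5 h6 h7 ih =>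
    intro hEN s b hsb hvb hbE hs
    obtain ⟨n, hn, heq⟩ := exists_headNorm_eq S x h3
    have hbn : g b ≤ n := hbE n (h4 hn)
    have hbn' : b ≤ n := (hg b).le.trans hbn
    have hs1 := (hins b v hvb s hsb n hbn).1 hs
    -- The drop from `v` to `v'` frees two derivatives, one spent on `n` and one on `g n`.
    have hle : 2 * v' + 3 ≤ 2 * v + 1 := by
      have : 2 * v' + 2 ≤ 2 * v := by
        rw [← mul_add_one]
        gcongr
        exact Order.add_one_le_of_lt h1
      calc 2 * v' + 3 = 2 * v' + 2 + 1 := by rw [add_assoc, two_add_one_eq_three]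
        _ ≤ 2 * v + 1 := by gcongr
    have hs1n : ∀ k ∈ insert n s, k ≤ n := by
      intro k hk
      rcases Finset.mem_insert.1 hk with rfl | hk
      · exact le_rfl
      · exact (hsb k hk).trans hbn'
    have hs2 := (hins n v' (h2 n hn) _ hs1n (g n) le_rfl).2 (cbIter_anti hle hs1)
    have hE₂ : ∀ k ∈ E₂, g (g n) ≤ k := fun k hk =>
      hN n (hEN (h4 hn)) k (hEN (h5 hk)) (h6 n hn k hk)
    have hfil : ∀ k ∈ E₁.filter (n < ·), g n ≤ k := by
      intro k hk
      rw [Finset.mem_filter] at hk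
      exact (hg _).le.trans (hN n (hEN (h4 hn)) k (hEN (h4 hk.1)) hk.2)
    have h8 := ih (fun k hk => hEN (h5 hk)) (insert (g n) (insert n s)) (g n)
      (by
        intro k hk
        rcases Finset.mem_insert.1 hk with rfl | hk
        · exact le_rfl
        · exact (hs1n k hk).trans (hg n).le)
      (hmono (hg n).le (h2 n hn)) hE₂ hs2
    have h9 : BlockSum F (fun G => tnorm S (restr G x)) (insert n s) (E₁.filter (n < ·) ∪ E₂) {g n}
        (tnorm S (restr (E₁.filter (n < ·)) x) + c) :=
      h8.cons hF hT Finset.subset_union_left Finset.subset_union_right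
        ⟨g n, Finset.mem_singleton_self _, le_rfl⟩
        (fun d hd => ⟨g n, Finset.mem_singleton_self _, (hg _).le.trans (hE₂ d hd)⟩) hfil
        (fun k hk => (hg _).trans_le (hE₂ k hk))
        (fun i hi j hj => h6 i (Finset.mem_filter.1 hi).1 j hj)
    have h10 : BlockSum F (fun G => tnorm S (restr G x)) s E E
        (tnorm S (restr {n} x) + (tnorm S (restr (E₁.filter (n < ·)) x) + c)) :=
      h9.cons hF hT (Finset.singleton_subset_iff.2 (h4 hn))
        (Finset.union_subset ((Finset.filter_subset _ _).trans h4) h5) ⟨n, h4 hn, le_rfl⟩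
        (by simpa using ⟨n, h4 hn, (hg n).le⟩) (by simp) (by simpa using hg n) (by simpa using hg n)
    obtain ⟨r, G, m, k1, k2, k3, k4, k5, k6, k7, k8⟩ := h10
    refine ⟨r, G, m, k1, k2, k3, k4, k5, k6, k7, le_trans ?_ k8⟩
    have := abs_le_tnorm_restr S x (Finset.mem_singleton_self n)
    rw [heq]
    linarith

/-- On a sufficiently sparse set of integers, `headNorm` absorbs the sequences labelled by ordinals
that are small compared with the index of a family. -/
lemma exists_theta_mul_labelledSup_le (i : I) (hS : IsSpreading (S.family i))
    {lab : ℕ → Set Ordinal.{0}} (hmono : Monotone lab) (hfin : ∀ n, (lab n).Finite)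
    {a : Ordinal.{0}} (ha : ∀ v < a, 2 * v + 3 < cbIndex (S.family i)) {M : Set ℕ}
    (hM : M.Infinite) : ∃ N ⊆ M, N.Infinite ∧ ∀ (x : ℕ →₀ ℝ) (E : Finset ℕ), ↑E ⊆ N →
      S.theta i * labelledSup lab a (headNorm S x) E ≤ headNorm S x E := by
  have hF := S.hereditary i
  obtain ⟨g, hg, hins⟩ := exists_insert_mem_cbIter hF hS.isShiftClosed lab hfin
  obtain ⟨N, hNM, hNinf, hN⟩ := exists_sparse_subset (fun n => g (g n)) hM
  refine ⟨N, hNM, hNinf, fun x E hEN => ?_⟩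
  have hT : (fun G => tnorm S (restr G x)) ∅ = 0 := by
    simp only [restr_empty, tnorm_zero]
  rw [mul_comm, ← le_div_iff₀ (S.theta_pos i)]
  refine labelledSup_le fun c hc => ?_
  rw [le_div_iff₀ (S.theta_pos i), mul_comm]
  cases hc with
  | nil => simpa using headNorm_nonneg S x E
  | @cons a v E E₁ E₂ c h1 h2 h3 h4 h5 h6 h7 =>
    -- Infinitely many labels may lie below `a`, and the first one is only known to belong to `lab
    -- n`, so no witness can be fixed before `n` is known. The coordinate `n` is therefore kept
    -- outside the admissible sum, as `headNorm` permits, and the witnesses start at `g n`.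
    obtain ⟨n, hn, heq⟩ := exists_headNorm_eq S x h3
    have hs := (hins n v (h2 n hn) ∅ (by simp) (g n) le_rfl).2 (empty_mem_cbIter hF (ha v h1))
    have hE₂ : ∀ k ∈ E₂, g (g n) ≤ k := fun k hk =>
      hN n (hEN (h4 hn)) k (hEN (h5 hk)) (h6 n hn k hk)
    have hfil : ∀ k ∈ E₁.filter (n < ·), g n ≤ k := by
      intro k hk
      rw [Finset.mem_filter] at hk
      exact (hg _).le.trans (hN n (hEN (h4 hn)) k (hEN (h4 hk.1)) hk.2)
    have h8 := h7.blockSum S x hF hmono hg hins hN (fun k hk => hEN (h5 hk)) (insert (g n) ∅) (g n)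
      (by simp) (hmono (hg n).le (h2 n hn)) hE₂ hs
    obtain ⟨r, G, m, k1, k2, k3, k4, k5, k6, k7, k8⟩ :
        BlockSum (S.family i) (fun G => tnorm S (restr G x)) ∅ (E.filter (n < ·)) {g n}
          (tnorm S (restr (E₁.filter (n < ·)) x) + c) :=
      h8.cons hF hT (Finset.filter_subset_filter _ h4)
        (fun k hk => Finset.mem_filter.2 ⟨h5 hk, h6 n hn k hk⟩)
        ⟨g n, Finset.mem_singleton_self _, le_rfl⟩
        (fun d hd => ⟨g n, Finset.mem_singleton_self _, (hg _).le.trans (hE₂ d hd)⟩) hfil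
        (fun k hk => (hg _).trans_le (hE₂ k hk))
        (fun i hi j hj => h6 i (Finset.mem_filter.1 hi).1 j hj)
    rw [Finset.empty_union] at k2
    have hadm : S.theta i * ∑ j, tnorm S (restr (G j) x) ≤
        tnorm S (restr (E.filter (n < ·)) x) := by
      refine (isLUB_tnorm S _).1 (Set.mem_insert_of_mem _ ⟨i, r, G, ⟨k3, m, k1, k2, k4, k5⟩, ?_⟩)
      congr 1
      refine Finset.sum_congr rfl fun j _ => ?_
      rw [restr_restr, Finset.inter_eq_left.2 (k6 j)]
    have h11 := le_headNorm S x (h4 hn)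
    have h12 : S.theta i * |x n| ≤ |x n| :=
      mul_le_of_le_one_left (abs_nonneg _) (S.theta_lt_one i).le
    calc S.theta i * (headNorm S x E₁ + c)
        = S.theta i * |x n| + S.theta i * (tnorm S (restr (E₁.filter (n < ·)) x) + c) := by
          rw [heq]; ring
      _ ≤ |x n| + tnorm S (restr (E.filter (n < ·)) x) :=
          add_le_add h12 ((mul_le_mul_of_nonneg_left k8 (S.theta_pos i).le).trans hadm)
      _ ≤ _ := h11

end

/-! ### Upper estimates for mixed norms -/

section

variable {lab : ℕ → Set Ordinal.{0}} {a : Ordinal.{0}} {V W : Finset ℕ → ℝ}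

lemma iterate_labelledSup_empty (hV : V ∅ = 0) (l : ℕ) : ((labelledSup lab a)^[l] V) ∅ = 0 := by
  cases l with
  | zero => exact hV
  | succ l => rw [Function.iterate_succ_apply']; exact labelledSup_empty

lemma le_iterate_labelledSup (ha : 0 < a) (h0 : ∀ n, 0 ∈ lab n) (hV : V ∅ = 0) (l : ℕ)
    (E : Finset ℕ) : V E ≤ ((labelledSup lab a)^[l] V) E := by
  induction l with
  | zero => exact le_rfl
  | succ l ih =>
    rw [Function.iterate_succ_apply']
    exact ih.trans (le_labelledSup ha h0 (iterate_labelledSup_empty hV l) E)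

/-- An operator on set functions is dominated by the sums along labelled sequences, for a finitary
system of labels below `a`. -/
def IsFinitary (Φ : (Finset ℕ → ℝ) → Finset ℕ → ℝ) (a : Ordinal.{0}) : Prop :=
  ∃ lab : ℕ → Set Ordinal.{0}, Monotone lab ∧ (∀ n, (lab n).Finite) ∧
    ∀ V, V ∅ = 0 → ∀ E, Φ V E ≤ labelledSup lab a V E

lemma isFinitary_id : IsFinitary id 1 :=
  ⟨fun _ => {0}, fun _ _ _ => le_rfl, fun _ => Set.finite_singleton _,
    fun _ hV => le_labelledSup one_pos (fun _ => Set.mem_singleton _) hV⟩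

lemma IsFinitary.labelledSup {Φ : (Finset ℕ → ℝ) → Finset ℕ → ℝ} {b : Ordinal.{0}}
    (h : IsFinitary Φ a) (hmono : Monotone lab) (hfin : ∀ n, (lab n).Finite) :
    IsFinitary (fun V => labelledSup lab b (Φ V)) (a * b) := by
  obtain ⟨labW, h1, h2, h3⟩ := h
  exact ⟨compLab lab a labW, fun m n hmn => Set.image2_subset (hmono hmn) (h1 hmn),
    fun n => (hfin n).image2 _ (h2 n), fun V hV E =>
      (labelledSup_le_labelledSup fun F _ => h3 V hV F).trans labelledSup_labelledSup_le⟩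

lemma IsFinitary.iterate {Φ : (Finset ℕ → ℝ) → Finset ℕ → ℝ} {b : Ordinal.{0}}
    (h : IsFinitary Φ a) (hmono : Monotone lab) (hfin : ∀ n, (lab n).Finite) (l : ℕ) :
    IsFinitary (fun V => (Tsirelson.labelledSup lab b)^[l] (Φ V)) (a * b ^ l) := by
  induction l with
  | zero => simpa using h
  | succ l ih =>
    simp only [Function.iterate_succ_apply', pow_succ, ← mul_assoc]
    exact ih.labelledSup hmono hfin

end

/-- The operator that applies `j` times, in alternation, `L` iterations of the supremum over
`labR`-sequences and the supremum over `labD`-sequences. -/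
def layers (labR labD : ℕ → Set Ordinal.{0}) (η κ : Ordinal.{0}) (L : ℕ) :
    ℕ → (Finset ℕ → ℝ) → Finset ℕ → ℝ
  | 0 => id
  | j + 1 => fun V => labelledSup labD κ
      ((labelledSup labR η)^[L] (layers labR labD η κ L j V))

section

variable {labR labD : ℕ → Set Ordinal.{0}} {η κ : Ordinal.{0}} {L : ℕ}

/-- By `η ^ L * κ = κ` the suprema over `labR`-sequences do not raise the order: only the number of
suprema over `labD`-sequences counts. -/
lemma isFinitary_layers (hR : Monotone labR) (hRf : ∀ n, (labR n).Finite) (hD : Monotone labD)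
    (hDf : ∀ n, (labD n).Finite) (hκ : η ^ L * κ = κ) (j : ℕ) :
    IsFinitary (layers labR labD η κ L j) (κ ^ j) := by
  induction j with
  | zero => simpa [layers] using isFinitary_id
  | succ j ih =>
    have := (ih.iterate hR hRf (b := η) L).labelledSup hD hDf (b := κ)
    rwa [mul_assoc, hκ, ← pow_succ] at this

lemma layers_empty {Q : Finset ℕ → ℝ} (hQ : Q ∅ = 0) (j : ℕ) :
    layers labR labD η κ L j Q ∅ = 0 := by
  cases j with
  | zero => exact hQ
  | succ j => exact labelledSup_empty

lemma le_layers {Q : Finset ℕ → ℝ} (hQ : Q ∅ = 0) (hη : 0 < η) (hκ : 0 < κ)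
    (h0R : ∀ n, 0 ∈ labR n) (h0D : ∀ n, 0 ∈ labD n) (j : ℕ) (E : Finset ℕ) :
    Q E ≤ layers labR labD η κ L j Q E := by
  induction j with
  | zero => exact le_rfl
  | succ j ih =>
    exact (ih.trans (le_iterate_labelledSup hη h0R (layers_empty hQ j) L E)).trans
      (le_labelledSup hκ h0D (iterate_labelledSup_empty (layers_empty hQ j) L) E)

/-- The set function `V`, weighted by powers of `τ`, is dominated by the layers over `Q`. -/
def LayerBound (labR labD : ℕ → Set Ordinal.{0}) (η κ : Ordinal.{0}) (L k : ℕ) (τ : ℝ)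
    (Q : Finset ℕ → ℝ) (N : Set ℕ) (V : Finset ℕ → ℝ) : Prop :=
  ∀ b j, b + j = k → ∀ E : Finset ℕ, ↑E ⊆ N →
    τ ^ b * V E ≤ ((labelledSup labR η)^[L] (layers labR labD η κ L j Q)) E

variable {k : ℕ} {τ : ℝ} {Q V : Finset ℕ → ℝ} {N : Set ℕ}

/-- The factor `τ` pays for the outer supremum: it turns `b` into `b + 1` and uses one of the `j`
remaining layers. -/
lemma LayerBound.mul_labelledSup_le (h : LayerBound labR labD η κ L k τ Q N V) (hτ : 0 < τ)
    (hk : 0 < k) (hQ : ∀ E : Finset ℕ, ↑E ⊆ N → τ ^ k * layers labR labD η κ L k Q E ≤ Q E)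
    {b j : ℕ} (hbj : b + j = k) {E : Finset ℕ} (hE : ↑E ⊆ N) :
    τ ^ b * (τ * labelledSup labD κ V E) ≤ layers labR labD η κ L j Q E := by
  have key : ∀ b j, b + (j + 1) = k →
      τ ^ b * (τ * labelledSup labD κ V E) ≤ layers labR labD η κ L (j + 1) Q E := by
    intro b j hbj
    rw [← mul_assoc, ← pow_succ]
    exact Tsirelson.mul_labelledSup_le (pow_pos hτ _).le fun F hF =>
      h (b + 1) j (by omega) F fun x hx => hE (hF hx)
  cases j with
  | succ j => exact key b j hbj
  -- No layer is left: `τ ^ k` is spent on absorbing `k` fresh layers into `Q`.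
  | zero =>
    obtain ⟨k, rfl⟩ := Nat.exists_eq_succ_of_ne_zero hk.ne'
    obtain rfl : b = k + 1 := hbj
    refine le_trans (mul_le_mul_of_nonneg_left ?_ (pow_pos hτ _).le) (hQ E hE)
    simpa using key 0 k (by omega)

/-- After each supremum the bound is padded with `L` unused suprema over `labR`-sequences, which
restores the form `LayerBound`. -/
lemma LayerBound.mul_iterate_labelledSup_le (h : LayerBound labR labD η κ L k τ Q N V)
    (hτ : 0 < τ) (hk : 0 < k) (hη : 0 < η) (h0R : ∀ n, 0 ∈ labR n) (hQ0 : Q ∅ = 0)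
    (hQ : ∀ E : Finset ℕ, ↑E ⊆ N → τ ^ k * layers labR labD η κ L k Q E ≤ Q E) (p : ℕ) :
    ∀ b j, b + j = k → ∀ E : Finset ℕ, ↑E ⊆ N →
      τ ^ b * (τ ^ (p + 1) * ((labelledSup labD κ)^[p + 1] V) E) ≤
        layers labR labD η κ L j Q E := by
  induction p with
  | zero =>
    intro b j hbj E hE
    simpa using h.mul_labelledSup_le hτ hk hQ hbj hE
  | succ p ih =>
    intro b j hbj E hE
    have h1 : LayerBound labR labD η κ L k τ Q N
        fun F => τ ^ (p + 1) * ((labelledSup labD κ)^[p + 1] V) F := fun b j hbj E hE =>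
      (ih b j hbj E hE).trans (le_iterate_labelledSup hη h0R (layers_empty hQ0 j) L E)
    refine le_trans (mul_le_mul_of_nonneg_left ?_ (pow_pos hτ _).le)
      (h1.mul_labelledSup_le hτ hk hQ hbj hE)
    rw [pow_succ' τ (p + 1), mul_assoc, Function.iterate_succ_apply']
    exact mul_le_mul_of_nonneg_left
      (Tsirelson.mul_labelledSup_le (pow_pos hτ _).le fun F _ => le_rfl) hτ.le

/-- If every sum along an admissible sequence is dominated by sums along labelled sequences whose
order fits the weights, then the mixed norm is dominated by the layers over `Q`. -/
lemma mul_stage_le {I : Type} (S : PairSeq I) (x : ℕ →₀ ℝ) {q : ℝ} {kk : I → ℕ} (hτ : 0 < τ)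
    (hτ1 : τ ≤ 1) (hq : 0 < q) (hq1 : q ≤ 1) (hL : 0 < L) (hqL : q ^ L ≤ τ) (hk : 0 < k)
    (hη : 0 < η) (hκ : 0 < κ) (h0R : ∀ n, 0 ∈ labR n) (h0D : ∀ n, 0 ∈ labD n)
    (hθq : ∀ i, S.theta i ≤ q) (hθτ : ∀ i, S.theta i ≤ τ ^ kk i)
    (hadm : ∀ (i : I) (n : ℕ) (G : Fin n → Finset ℕ), IsAdmissible (S.family i) G →
      ∀ V : Finset ℕ → ℝ, V ∅ = 0 → Monotone V → ∀ E,
        ∑ j, V (G j ∩ E) ≤ labelledSup labR η ((labelledSup labD κ)^[kk i] V) E)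
    (hQ0 : Q ∅ = 0) (hQx : ∀ E, supNorm (restr E x) ≤ Q E)
    (hQ : ∀ E : Finset ℕ, ↑E ⊆ N → τ ^ k * layers labR labD η κ L k Q E ≤ Q E) (m : ℕ) :
    ∀ a l, a + l = L → ∀ b j, b + j = k → ∀ E : Finset ℕ, ↑E ⊆ N →
      q ^ a * τ ^ b * stage S m (restr E x) ≤
        ((labelledSup labR η)^[l] (layers labR labD η κ L j Q)) E := by
  -- `a` and `b` count the suprema of each kind already paid for, `l` and `j` those still available.
  have hw : ∀ a b, 0 < q ^ a * τ ^ b := fun a b => mul_pos (pow_pos hq a) (pow_pos hτ b)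
  have hsup : ∀ a b j l E, q ^ a * τ ^ b * supNorm (restr E x) ≤
      ((labelledSup labR η)^[l] (layers labR labD η κ L j Q)) E := fun a b j l E =>
    calc q ^ a * τ ^ b * supNorm (restr E x) ≤ supNorm (restr E x) :=
          mul_le_of_le_one_left (supNorm_nonneg _)
            (mul_le_one₀ (pow_le_one₀ hq.le hq1) (pow_pos hτ b).le (pow_le_one₀ hτ.le hτ1))
      _ ≤ Q E := hQx E
      _ ≤ layers labR labD η κ L j Q E := le_layers hQ0 hη hκ h0R h0D j E
      _ ≤ _ := le_iterate_labelledSup hη h0R (layers_empty hQ0 j) l E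
  induction m with
  | zero => exact fun a l _ b j _ E _ => hsup a b j l E
  | succ m ih =>
    set V : Finset ℕ → ℝ := fun E => stage S m (restr E x) with hVdef
    have hV0 : V ∅ = 0 := by
      simp only [hVdef, restr_empty, stage_zero]
    have hVm : Monotone V := fun E E' h => stage_restr_mono S x m h
    have hV : LayerBound labR labD η κ L k τ Q N V := fun b j hbj E hE => by
      simpa using ih 0 L (zero_add L) b j hbj E hE
    have main : ∀ a l, a + (l + 1) = L → ∀ b j, b + j = k → ∀ E : Finset ℕ, ↑E ⊆ N →
        q ^ a * τ ^ b * stage S (m + 1) (restr E x) ≤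
          ((labelledSup labR η)^[l + 1] (layers labR labD η κ L j Q)) E := by
      intro a l hal b j hbj E hE
      rw [mul_comm, ← le_div_iff₀ (hw a b)]
      refine stage_succ_le S ?_ ?_
      · rw [le_div_iff₀ (hw a b), mul_comm]
        exact hsup a b j _ E
      rintro _ ⟨i, n, G, hG, rfl⟩
      rw [le_div_iff₀ (hw a b), mul_comm]
      have h1 : ∑ t, stage S m (restr (G t) (restr E x)) ≤
          labelledSup labR η ((labelledSup labD κ)^[kk i] V) E := by
        simp only [restr_restr]
        exact hadm i n G hG V hV0 hVm E
      have h2 : q ^ a * τ ^ b * (S.theta i * ∑ t, stage S m (restr (G t) (restr E x))) ≤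
          q ^ a * τ ^ b * (S.theta i * labelledSup labR η ((labelledSup labD κ)^[kk i] V) E) :=
        mul_le_mul_of_nonneg_left (mul_le_mul_of_nonneg_left h1 (S.theta_pos i).le) (hw a b).le
      refine h2.trans ?_
      have hnn : 0 ≤ labelledSup labR η ((labelledSup labD κ)^[kk i] V) E := labelledSup_nonneg
      cases hki : kk i with
      -- There is no power of `τ` here; a factor `q` pays for one of the `L` suprema over
      -- `labR`-sequences.
      | zero =>
        rw [hki] at hnn
        rw [Function.iterate_succ_apply']
        calc q ^ a * τ ^ b * (S.theta i * labelledSup labR η ((labelledSup labD κ)^[0] V) E)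
            ≤ q ^ a * τ ^ b * (q * labelledSup labR η ((labelledSup labD κ)^[0] V) E) := by
              gcongr
              exact hθq i
          _ = q ^ (a + 1) * τ ^ b * labelledSup labR η V E := by
              rw [Function.iterate_zero_apply]; ring
          _ ≤ _ := Tsirelson.mul_labelledSup_le (hw _ _).le fun F hF =>
              ih (a + 1) l (by omega) b j hbj F fun x hx => hE (hF hx)
      -- `τ ^ (p + 1)` pays for the inner suprema. The factor `q ^ a` can be dropped, because each
      -- layer inside again offers all `L` suprema over `labR`-sequences.
      | succ p =>
        rw [hki] at hnn
        have h3 := hθτ i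
        rw [hki] at h3
        calc q ^ a * τ ^ b * (S.theta i * labelledSup labR η ((labelledSup labD κ)^[p + 1] V) E)
            ≤ 1 * τ ^ b * (τ ^ (p + 1) * labelledSup labR η ((labelledSup labD κ)^[p + 1] V) E) := by
              gcongr
              · exact mul_nonneg (S.theta_pos i).le hnn
              · exact pow_le_one₀ hq.le hq1
          _ = τ ^ b * τ ^ (p + 1) * labelledSup labR η ((labelledSup labD κ)^[p + 1] V) E := by ring
          _ ≤ labelledSup labR η (layers labR labD η κ L j Q) E := by
              refine Tsirelson.mul_labelledSup_le (by positivity) fun F hF => ?_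
              rw [mul_assoc]
              exact hV.mul_iterate_labelledSup_le hτ hk hη h0R hQ0 hQ p b j hbj F
                fun x hx => hE (hF hx)
          _ ≤ _ := by
              rw [Function.iterate_succ_apply]
              exact le_iterate_labelledSup hη h0R labelledSup_empty l E
    intro a l hal b j hbj E hE
    cases l with
    | succ l => exact main a l hal b j hbj E hE
    -- The `L` suprema are used up. Now `q ^ L ≤ τ` buys a one-term sum of order `κ`, inside which
    -- the count restarts from `a = 0`.
    | zero =>
      obtain rfl : a = L := hal
      have hV' : LayerBound labR labD η κ a k τ Q N fun E => stage S (m + 1) (restr E x) := by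
        intro b j hbj E hE
        obtain ⟨L', rfl⟩ := Nat.exists_eq_succ_of_ne_zero hL.ne'
        simpa using main 0 L' (zero_add _) b j hbj E hE
      have h1 : (fun E => stage S (m + 1) (restr E x)) ∅ = 0 := by
        simp only [restr_empty, stage_zero]
      calc q ^ a * τ ^ b * stage S (m + 1) (restr E x)
          ≤ τ * τ ^ b * stage S (m + 1) (restr E x) := by
            gcongr
            exact stage_nonneg S _ _
        _ = τ ^ b * (τ * stage S (m + 1) (restr E x)) := by ring
        _ ≤ τ ^ b * (τ * labelledSup labD κ (fun E => stage S (m + 1) (restr E x)) E) := by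
            gcongr
            exact le_labelledSup (V := fun E => stage S (m + 1) (restr E x)) hκ h0D h1 E
        _ ≤ _ := hV'.mul_labelledSup_le hτ hk hQ hbj hE

/-- Labels are expanded in base `κ`: `labD` contains the `p` lowest digits, `labR` the leading
quotient. -/
lemma labelledSup_pow_mul_le {lab : ℕ → Set Ordinal.{0}} (hκ : κ ≠ 0) (hR : Monotone labR)
    (hD : Monotone labD) {p : ℕ} (hlabR : ∀ n, ∀ u ∈ lab n, u / κ ^ p ∈ labR n)
    (hlabD : ∀ n, ∀ u ∈ lab n, ∀ t < p, u % κ ^ (t + 1) / κ ^ t ∈ labD n) (hVm : Monotone V)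
    (hV : V ∅ = 0) (E : Finset ℕ) :
    labelledSup lab (κ ^ p * η) V E ≤ labelledSup labR η ((labelledSup labD κ)^[p] V) E := by
  have hpow : ∀ t : ℕ, κ ^ t ≠ 0 := fun t => pow_ne_zero t hκ
  have key : ∀ t ≤ p, ∀ E, labelledSup (fun n => (· % κ ^ t) '' lab n) (κ ^ t) V E ≤
      ((labelledSup labD κ)^[t] V) E := by
    intro t
    induction t with
    | zero =>
      intro _ E
      refine labelledSup_le fun c hc => ?_
      rw [Function.iterate_zero_apply]
      cases hc with
      | nil => rw [← hV]; exact hVm (Finset.empty_subset E)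
      -- A label below `κ ^ 0` is `0`, so the sequence has only one set.
      | @cons _ v _ E₁ E₂ c h1 h2 h3 h4 h5 h6 h7 =>
        rw [pow_zero, Order.lt_one_iff] at h1
        subst h1
        cases h7 with
        | nil => simpa using hVm h4
        | cons h => exact absurd h not_lt_zero
    | succ t ih =>
      intro ht E
      rw [pow_succ, Function.iterate_succ_apply']
      refine (labelledSup_le_of_div_mod (labW := fun n => (· % κ ^ t) '' lab n) hD (hpow t)
        ?_).trans (labelledSup_le_labelledSup fun F _ => ih (by omega) F)
      rintro n _ ⟨u, hu, rfl⟩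
      refine ⟨?_, u, hu, ?_⟩
      · rw [← pow_succ]
        exact hlabD n u hu t (by omega)
      · exact (Ordinal.mod_mod_of_dvd u (dvd_mul_right _ _)).symm
  exact (labelledSup_le_of_div_mod (labW := fun n => (· % κ ^ p) '' lab n) hR (hpow p)
    fun n u hu => ⟨hlabR n u hu, u, hu, rfl⟩).trans
      (labelledSup_le_labelledSup fun F _ => key p le_rfl F)

end

/-- The ranks of the nonempty sets of integers up to `n`. -/
def rankLab (F : Set (Finset ℕ)) (n : ℕ) : Set Ordinal.{0} :=
  cbRank F '' {s | s.Nonempty ∧ s ⊆ Finset.range (n + 1)}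

lemma rankLab_mono (F : Set (Finset ℕ)) : Monotone (rankLab F) := fun m n h =>
  Set.image_mono fun _ hs => ⟨hs.1, hs.2.trans (Finset.range_subset_range.2 (by omega))⟩

lemma finite_rankLab (F : Set (Finset ℕ)) (n : ℕ) : (rankLab F n).Finite := by
  refine Set.Finite.image _ ((Finset.range (n + 1)).powerset.finite_toSet.subset fun s hs => ?_)
  exact Finset.mem_coe.2 (Finset.mem_powerset.2 hs.2)

/-- The `j`-th set is labelled by the rank of `{m_0, ..., m_j}`. These ranks decrease along end
extensions, and no `m_i` with `i ≤ j` exceeds a point of `G j`, so the label is available there. -/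
lemma IsAdmissible.sum_le_labelledSup {F : Set (Finset ℕ)} (hF : IsCompactFamily F)
    (hH : IsHereditary F) (hS : IsShiftClosed F) {n : ℕ} {G : Fin n → Finset ℕ}
    (hG : IsAdmissible F G) {V : Finset ℕ → ℝ} (hV : V ∅ = 0) (E : Finset ℕ) {a : Ordinal.{0}}
    (ha : cbIndex F < a) : ∑ j, V (G j ∩ E) ≤ labelledSup (rankLab F) a V E := by
  obtain ⟨-, m, hm, hmF, h1, h2⟩ := hG
  let s : Fin n → Finset ℕ := fun j => (Finset.univ.filter (· ≤ j)).image m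
  have hs : ∀ j y, y ∈ s j ↔ ∃ i ≤ j, m i = y := by simp [s]
  have hne : ∀ j, (s j).Nonempty := fun j => ⟨m j, (hs _ _).2 ⟨j, le_rfl, rfl⟩⟩
  have hsF : ∀ j, s j ∈ F := fun j =>
    hH _ hmF _ (Finset.image_subset_image (Finset.filter_subset _ _))
  have hsum := LabelledSum.of_fin (lab := rankLab F) (a := a) (V := V) (fun j => G j ∩ E)
    (fun j => cbRank F (s j)) hV ?_ ?_ ?_ ?_
  · refine (hsum.mono le_rfl ?_).le_labelledSup
    exact Finset.biUnion_subset.2 fun j _ => Finset.inter_subset_right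
  · intro i j hij k hk l hl
    rw [Finset.mem_inter] at hk hl
    exact (h2 i j hij k hk.1).trans_le (h1 j l hl.1)
  · intro i j hij
    refine cbRank_lt hF hH hS (hne i) (hsF j) ?_ ?_ ?_
    · intro y hy
      obtain ⟨t, ht, rfl⟩ := (hs _ _).1 hy
      exact (hs _ _).2 ⟨t, ht.trans hij.le, rfl⟩
    · intro h
      have : m j ∈ s i := h ▸ (hs _ _).2 ⟨j, le_rfl, rfl⟩
      obtain ⟨t, ht, he⟩ := (hs _ _).1 this
      exact absurd (hm.injective he ▸ ht) (not_le.2 hij)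
    · intro y hy z hz hzs
      obtain ⟨t, ht, rfl⟩ := (hs _ _).1 hy
      obtain ⟨u, hu, rfl⟩ := (hs _ _).1 hz
      refine hm (lt_of_not_ge fun hle => hzs ?_)
      exact (hs _ _).2 ⟨u, hle.trans ht, rfl⟩
  · intro j k hk
    refine ⟨s j, ⟨hne j, fun y hy => ?_⟩, rfl⟩
    obtain ⟨t, ht, rfl⟩ := (hs _ _).1 hy
    have := h1 j k (Finset.mem_inter.1 hk).1
    have := hm.monotone ht
    rw [Finset.mem_range]
    omega
  · exact fun j => (cbRank_le hF (hne j)).trans_lt ha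

/-! ### Ordinal estimates -/

-- With δ = λ(λ(α)), combine ω^λ(α) ≤ α < ω^(λ(α)+1) with ω^δ n ≤ λ(α) < ω^δ (n+1); the last strict
-- inequality absorbs the successor.
open Ordinal in
lemma exists_coeff_lam {α : Ordinal.{0}} (hα : ω ≤ α) :
    ∃ n : ℕ, 0 < n ∧ coeff (lam α) = n ∧ (ω ^ ω ^ lam (lam α)) ^ n ≤ α ∧
      α < (ω ^ ω ^ lam (lam α)) ^ (n + 1) := by
  have hα0 : α ≠ 0 := (omega0_pos.trans_le hα).ne'
  have hβ0 : lam α ≠ 0 := (log_pos one_lt_omega0 hα0 hα).ne'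
  obtain ⟨n, hn⟩ := lt_omega0.1 (div_opow_log_lt (lam α) one_lt_omega0)
  have hn0 : 0 < lam α / ω ^ log ω (lam α) := div_opow_log_pos ω hβ0
  have h1 : ω ^ lam (lam α) * n ≤ lam α := by
    rw [← hn]; exact mul_div_le _ _
  have h2 : lam α < ω ^ lam (lam α) * (n + 1 : ℕ) := by
    rw [Nat.cast_add, Nat.cast_one, ← hn]
    exact lt_mul_succ_div _ (opow_pos _ omega0_pos).ne'
  refine ⟨n, ?_, hn, ?_, ?_⟩
  · rw [hn] at hn0
    exact_mod_cast hn0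
  · rw [← opow_natCast, ← opow_mul]
    exact (opow_le_opow_right omega0_pos h1).trans (opow_log_le_self ω hα0)
  · rw [← opow_natCast, ← opow_mul]
    exact (lt_opow_succ_log_self one_lt_omega0 α).trans_le
      (opow_le_opow_right omega0_pos (Order.succ_le_of_lt h2))

-- For finite `α₁` the right-hand power in the comparison is finite, while the left-hand one is
-- infinite.
open Ordinal in
lemma omega0_le_of_TLe {α₀ α₁ : Ordinal.{0}} {θ₀ θ₁ : ℝ} (h : TLe α₀ θ₀ α₁ θ₁) (h₀ : ω ≤ α₀) :
    ω ≤ α₁ := by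
  by_contra! h₁
  rcases h with ⟨h, -⟩ | ⟨-, m₀, m₁, hm₀, hm₁, hle, -⟩
  · exact absurd h₀ (not_le.2 h)
  · obtain ⟨n, hn, hn', -⟩ := exists_coeff_lam h₀
    have hg : gam α₁ < ω := by
      rw [gam, if_pos h₁]
      exact (div_le_of_le_mul (by
        calc α₁ = 1 * α₁ := (one_mul _).symm
          _ ≤ _ := by gcongr; exact Order.one_le_iff_pos.2 (opow_pos _ omega0_pos))).trans_lt h₁
    obtain ⟨b, hb⟩ := lt_omega0.1 hg
    have hnn : nn α₁ = 1 := if_pos h₁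
    rw [hb, hnn, one_mul, opow_natCast, ← natCast_pow, gam, if_neg (not_lt.2 h₀), nn,
      if_neg (not_lt.2 h₀), hn'] at hle
    refine absurd (hle.trans_lt (natCast_lt_omega0 _)) (not_lt.2 ?_)
    calc ω ≤ ω ^ ω ^ lam (lam α₀) := left_le_opow _ (opow_pos _ omega0_pos)
      _ ≤ _ := left_le_opow _ (by exact_mod_cast Nat.mul_pos hn hm₀)

-- If `α₀` is finite or λ(λ(α₀)) < λ(λ(α₁)), then `p = 0` works. If the two exponents agree, `p` is
-- the coefficient `n` of `α₀`, and `n * m₀ ≤ k * m₁` transfers the inequality of the weights. A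
-- larger exponent for `α₀` is excluded.
open Ordinal in
lemma TLe.exists_lt_pow {α₀ α₁ : Ordinal.{0}} {θ₀ θ₁ : ℝ} (h : TLe α₀ θ₀ α₁ θ₁) (h₁ : ω ≤ α₁)
    (hθ₀ : 0 < θ₀) (hθ₁ : 0 < θ₁) (hθ₁' : θ₁ < 1) (hθ₀' : θ₀ < 1) {k : ℕ}
    (hk : coeff (lam α₁) = k) :
    ∃ p : ℕ, α₀ < (ω ^ ω ^ lam (lam α₁)) ^ (p + 1) ∧ θ₀ ^ k ≤ θ₁ ^ p := by
  have h01 : θ₀ ^ k ≤ θ₁ ^ 0 := by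
    rw [pow_zero]; exact pow_le_one₀ hθ₀.le hθ₀'.le
  have hω : ω ≤ ω ^ ω ^ lam (lam α₁) := left_le_opow _ (opow_pos _ omega0_pos)
  rcases lt_or_ge α₀ ω with h₀ | h₀
  · exact ⟨0, by simpa using h₀.trans_le hω, h01⟩
  rcases h with ⟨h, -⟩ | ⟨-, m₀, m₁, hm₀, hm₁, hle, hpow⟩
  · exact absurd h₀ (not_le.2 h)
  obtain ⟨n, hn, hn', -, hlt⟩ := exists_coeff_lam h₀
  rw [gam, if_neg (not_lt.2 h₀), nn, if_neg (not_lt.2 h₀), gam, if_neg (not_lt.2 h₁), nn,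
    if_neg (not_lt.2 h₁), hn', hk, ← opow_mul, ← opow_mul,
    opow_le_opow_iff_right one_lt_omega0] at hle
  have hle' : ω ^ lam (lam α₀) * (n * m₀ : ℕ) ≤ ω ^ lam (lam α₁) * (k * m₁ : ℕ) := by
    push_cast; exact hle
  rcases lt_trichotomy (lam (lam α₀)) (lam (lam α₁)) with hδ | hδ | hδ
  · refine ⟨0, hlt.trans ?_, h01⟩
    rw [← opow_natCast, ← opow_mul, zero_add, pow_one, opow_lt_opow_iff_right one_lt_omega0]
    exact opow_mul_lt_opow (natCast_lt_omega0 _) hδ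
  · rw [hδ] at hlt hle'
    refine ⟨n, hlt, ?_⟩
    have hnm : n * m₀ ≤ k * m₁ := by
      by_contra! hcon
      refine absurd hle' (not_le.2 ?_)
      gcongr
      exact opow_pos _ omega0_pos
    refine le_of_pow_le_pow_left₀ hm₀.ne' (pow_pos hθ₁ _).le ?_
    calc (θ₀ ^ k) ^ m₀ = (θ₀ ^ m₀) ^ k := by rw [← pow_mul, ← pow_mul, mul_comm]
      _ ≤ (θ₁ ^ m₁) ^ k := pow_le_pow_left₀ (pow_pos hθ₀ _).le hpow k
      _ = θ₁ ^ (k * m₁) := by rw [← pow_mul, mul_comm]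
      _ ≤ θ₁ ^ (n * m₀) := pow_le_pow_of_le_one hθ₁.le hθ₁'.le hnm
      _ = (θ₁ ^ n) ^ m₀ := pow_mul _ _ _
  · refine absurd hle' (not_le.2 ((opow_mul_lt_opow (natCast_lt_omega0 _) hδ).trans_le ?_))
    calc ω ^ lam (lam α₀) = ω ^ lam (lam α₀) * (1 : ℕ) := by simp
      _ ≤ _ := by gcongr; exact Nat.mul_pos hn hm₀

-- The two witnesses per label are harmless: `2 * ω = ω` and additive indecomposability keep the
-- doubled labels below the same power.
open Ordinal in
lemma two_mul_add_three_lt (δ : Ordinal.{0}) {k : ℕ} (hk : 0 < k) {v : Ordinal.{0}}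
    (hv : v < (ω ^ ω ^ δ) ^ k) : 2 * v + 3 < (ω ^ ω ^ δ) ^ k := by
  rw [← opow_natCast, ← opow_mul] at hv ⊢
  have he : 1 ≤ ω ^ δ * (k : Ordinal.{0}) :=
    Order.one_le_iff_pos.2 (mul_pos (opow_pos _ omega0_pos) (by exact_mod_cast hk))
  have hle : ω ≤ ω ^ (ω ^ δ * (k : Ordinal.{0})) := left_le_opow _ (Order.one_le_iff_pos.1 he)
  have h2 : 2 * ω ^ (ω ^ δ * (k : Ordinal.{0})) = ω ^ (ω ^ δ * (k : Ordinal.{0})) := by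
    refine mul_omega0_dvd two_pos (natCast_lt_omega0 2) ?_
    simpa using opow_dvd_opow ω he
  refine isPrincipal_add_omega0_opow _ ?_ ((natCast_lt_omega0 3).trans_le hle)
  calc 2 * v < 2 * ω ^ (ω ^ δ * (k : Ordinal.{0})) := by gcongr
    _ = _ := h2

/-! ### Comparison of the norms -/

open Ordinal in
/-- The upper estimate for the mixed norm on a sparse set of integers. -/
lemma exists_tnorm_le {I : Type} [Fintype I] (S : PairSeq I) (hreg : S.IsRegular) (i₀ : I)
    {δ : Ordinal.{0}} {k : ℕ} (hk : 0 < k) (hi₀ : (ω ^ ω ^ δ) ^ k ≤ cbIndex (S.family i₀))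
    {p : I → ℕ} (hp : ∀ i, cbIndex (S.family i) < (ω ^ ω ^ δ) ^ (p i + 1))
    (hθ : ∀ i, S.theta i ^ k ≤ S.theta i₀ ^ p i) {M : Set ℕ} (hM : M.Infinite) :
    ∃ N ⊆ M, N.Infinite ∧ ∃ C : ℝ, 0 < C ∧ ∀ x : ℕ →₀ ℝ, ↑x.support ⊆ N →
      tnorm S x ≤ C * tnorm (S.single i₀) x := by
  set κ : Ordinal.{0} := ω ^ ω ^ δ with hκ
  have hκ0 : 0 < κ := opow_pos _ omega0_pos
  have hωκ : ω ≤ κ := left_le_opow _ (opow_pos _ omega0_pos)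
  have hθ0 := S.theta_pos i₀
  have hθ1 := S.theta_lt_one i₀
  obtain ⟨τ, hτ0, hτk⟩ : ∃ τ : ℝ, 0 < τ ∧ τ ^ k = S.theta i₀ :=
    ⟨S.theta i₀ ^ ((k : ℝ)⁻¹), Real.rpow_pos_of_pos hθ0 _, Real.rpow_inv_natCast_pow hθ0.le hk.ne'⟩
  have hτ1 : τ < 1 := by
    rw [← pow_lt_one_iff_of_nonneg hτ0.le hk.ne', hτk]
    exact hθ1
  have hθτ : ∀ i, S.theta i ≤ τ ^ p i := by
    intro i
    refine le_of_pow_le_pow_left₀ hk.ne' (pow_pos hτ0 _).le ((hθ i).trans_eq ?_)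
    rw [← hτk, ← pow_mul, ← pow_mul, mul_comm]
  have : Nonempty I := ⟨i₀⟩
  obtain ⟨i₁, hi₁⟩ := Finite.exists_max S.theta
  set q := S.theta i₁ with hq
  have hq0 : 0 < q := S.theta_pos i₁
  have hq1 : q < 1 := S.theta_lt_one i₁
  -- The number of factors `q` that together are worth one factor `τ`.
  obtain ⟨L, hL⟩ := exists_pow_lt_of_lt_one hτ0 hq1
  have hL0 : 0 < L := by
    rcases Nat.eq_zero_or_pos L with rfl | h
    · rw [pow_zero] at hL
      exact absurd hL (not_lt.2 hτ1.le)
    · exact h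
  -- The added `1` makes the bounds `cbIndex < κ ^ p i * η` strict, as needed because a rank may
  -- equal the index.
  set η : Ordinal.{0} := Finset.univ.sup (fun i => cbIndex (S.family i) / κ ^ p i) + 1 with hη
  have hη0 : 0 < η := Order.lt_add_one_iff.2 zero_le
  have hηκ : η < κ := by
    have h1 : Finset.univ.sup (fun i => cbIndex (S.family i) / κ ^ p i) < κ := by
      rw [Finset.sup_lt_iff (by simpa using hκ0)]
      intro i _
      rw [← Ordinal.lt_mul_iff_div_lt (pow_ne_zero _ hκ0.ne'), ← pow_succ]
      exact hp i
    exact isPrincipal_add_omega0_opow _ h1 (one_lt_omega0.trans_le hωκ)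
  -- `κ` is multiplicatively indecomposable.
  have hηL : η ^ L * κ = κ := by
    clear hL hL0
    induction L with
    | zero => simp
    | succ L ih => rw [pow_succ, mul_assoc, mul_omega0_opow_opow hη0 hηκ, ih]
  have hind : ∀ i, cbIndex (S.family i) < κ ^ p i * η := by
    intro i
    rw [Ordinal.lt_mul_iff_div_lt (pow_ne_zero _ hκ0.ne')]
    exact Order.lt_add_one_iff.2
      (Finset.le_sup (f := fun i => cbIndex (S.family i) / κ ^ p i) (Finset.mem_univ i))
  -- All families share these labels; `0` is added so that one-term sequences are always available.
  let labR : ℕ → Set Ordinal.{0} := fun n =>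
    {0} ∪ ⋃ i, (fun u => u / κ ^ p i) '' rankLab (S.family i) n
  let labD : ℕ → Set Ordinal.{0} := fun n =>
    {0} ∪ ⋃ i, ⋃ t : Fin (p i),
      (fun u => u % κ ^ ((t : ℕ) + 1) / κ ^ (t : ℕ)) '' rankLab (S.family i) n
  have hR : Monotone labR := fun m n h => Set.union_subset_union_right _
    (Set.iUnion_mono fun i => Set.image_mono (rankLab_mono _ h))
  have hD : Monotone labD := fun m n h => Set.union_subset_union_right _
    (Set.iUnion_mono fun i => Set.iUnion_mono fun t => Set.image_mono (rankLab_mono _ h))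
  have hRf : ∀ n, (labR n).Finite := fun n => (Set.finite_singleton 0).union
    (Set.finite_iUnion fun i => (finite_rankLab _ n).image _)
  have hDf : ∀ n, (labD n).Finite := fun n => (Set.finite_singleton 0).union
    (Set.finite_iUnion fun i => Set.finite_iUnion fun t => (finite_rankLab _ n).image _)
  have h0R : ∀ n, 0 ∈ labR n := fun n => Or.inl rfl
  have h0D : ∀ n, 0 ∈ labD n := fun n => Or.inl rfl
  obtain ⟨lab, hlab, hlabf, hflat⟩ := isFinitary_layers hR hRf hD hDf hηL k
  obtain ⟨N, hNM, hNinf, hN⟩ := exists_theta_mul_labelledSup_le (S.single i₀) () (hreg i₀) hlab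
    hlabf (fun v hv => (two_mul_add_three_lt δ hk hv).trans_le hi₀) hM
  have hqτ : 0 < q ^ L * τ ^ k := mul_pos (pow_pos hq0 L) (pow_pos hτ0 k)
  -- The weights `q ^ L` and `τ ^ k` correspond to the state with no supremum left, where the bound
  -- is `Q` itself; the `2` comes from `headNorm_le`.
  refine ⟨N, hNM, hNinf, 2 / (q ^ L * τ ^ k), by positivity, fun x hx => ciSup_le fun m => ?_⟩
  have hx' : restr x.support x = x := by
    ext n
    by_cases h : x n = 0 <;> simp [restr_apply, h]
  have hadm : ∀ (i : I) (n : ℕ) (G : Fin n → Finset ℕ), IsAdmissible (S.family i) G →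
      ∀ V : Finset ℕ → ℝ, V ∅ = 0 → Monotone V → ∀ E,
        ∑ j, V (G j ∩ E) ≤ labelledSup labR η ((labelledSup labD κ)^[p i] V) E := by
    intro i n G hG V hV hVm E
    refine (hG.sum_le_labelledSup (S.compact i) (S.hereditary i) (hreg i).isShiftClosed hV E
      (hind i)).trans (labelledSup_pow_mul_le hκ0.ne' hR hD ?_ ?_ hVm hV E)
    · exact fun n u hu => Or.inr (Set.mem_iUnion.2 ⟨i, u, hu, rfl⟩)
    · exact fun n u hu t ht => Or.inr (Set.mem_iUnion.2 ⟨i, Set.mem_iUnion.2 ⟨⟨t, ht⟩, u, hu, rfl⟩⟩)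
  have hQ0 := headNorm_empty (S.single i₀) x
  have h := mul_stage_le S x hτ0 hτ1.le hq0 hq1.le hL0 hL.le hk hη0 hκ0 h0R h0D hi₁ hθτ hadm hQ0
    (supNorm_restr_le_headNorm (S.single i₀) x) (N := N) (fun E hE => by
      rw [hτk]
      exact (mul_le_mul_of_nonneg_left (hflat _ hQ0 E) hθ0.le).trans (hN x E hE))
    m L 0 (add_zero L) k 0 (add_zero k) x.support hx
  have h2 := headNorm_le (S.single i₀) x x.support
  rw [hx'] at h h2
  rw [div_mul_eq_mul_div, le_div_iff₀ hqτ, mul_comm]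
  exact h.trans h2

lemma stage_single_le {I : Type} (S : PairSeq I) (i : I) (k : ℕ) :
    ∀ x, stage (S.single i) k x ≤ stage S k x := by
  induction k with
  | zero => exact fun x => le_rfl
  | succ k ih =>
    intro x
    refine stage_succ_le _ (supNorm_le_stage S _ x) ?_
    rintro _ ⟨_, n, G, hG, rfl⟩
    exact (mul_le_mul_of_nonneg_left (Finset.sum_le_sum fun j _ => ih _) (S.theta_pos i).le).trans
      (le_stage_succ S k x ⟨i, n, G, hG, rfl⟩)

lemma tnorm_single_le {I : Type} (S : PairSeq I) (i : I) (x : ℕ →₀ ℝ) :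
    tnorm (S.single i) x ≤ tnorm S x :=
  ciSup_le fun k => (stage_single_le S i k x).trans (stage_le_tnorm S k x)

lemma norm_sum_basis {I : Type} (S : PairSeq I) {N : Set ℕ} (a : N →₀ ℝ) :
    ‖a.sum fun n c => c • S.basis (n : ℕ)‖ = tnorm S (a.mapDomain Subtype.val) := by
  let f : CZeroZero S →ₗᵢ[ℝ] S.Space := UniformSpace.Completion.toComplₗᵢ
  have h1 : (a.sum fun n c => c • S.basis (n : ℕ)) =
      f (a.sum fun n c => (show CZeroZero S from Finsupp.single (n : ℕ) c)) := by
    rw [map_finsuppSum]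
    refine Finsupp.sum_congr fun n _ => ?_
    have h2 : (show CZeroZero S from Finsupp.single (n : ℕ) (a n)) =
        a n • (show CZeroZero S from Finsupp.single (n : ℕ) (1 : ℝ)) := by
      change Finsupp.single (n : ℕ) (a n) = a n • Finsupp.single (n : ℕ) (1 : ℝ)
      simp
    rw [h2, map_smul]
    rfl
  rw [h1, f.norm_map]
  rfl

end Tsirelson

end

theorem mainTheorem5 (r : ℕ) (S : Tsirelson.PairSeq (Fin r)) (hreg : S.IsRegular)
    (hinf : ∃ i, Ordinal.omega0 ≤ Tsirelson.cbIndex (S.family i))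
    (i₀ : Fin r)
    (hmax : ∀ i, Tsirelson.TLe (Tsirelson.cbIndex (S.family i)) (S.theta i)
      (Tsirelson.cbIndex (S.family i₀)) (S.theta i₀))
    (M : Set ℕ) (hM : M.Infinite) :
    ∃ N : Set ℕ, N ⊆ M ∧ N.Infinite ∧
      Tsirelson.SeqEquivalent (fun n : N => S.basis (n : ℕ))
        (fun n : N => (S.single i₀).basis (n : ℕ)) := by
  obtain ⟨i, hi⟩ := hinf
  have hi₀ := Tsirelson.omega0_le_of_TLe (hmax i) hi
  obtain ⟨k, hk, hk', hle, -⟩ := Tsirelson.exists_coeff_lam hi₀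
  choose p hp hθ using fun i => (hmax i).exists_lt_pow hi₀ (S.theta_pos i) (S.theta_pos i₀)
    (S.theta_lt_one i₀) (S.theta_lt_one i) hk'
  obtain ⟨N, hNM, hNinf, C, hC0, hC⟩ := Tsirelson.exists_tnorm_le S hreg i₀ hk hle hp hθ hM
  refine ⟨N, hNM, hNinf, max C 1, le_max_right _ _, fun a => ?_⟩
  rw [Tsirelson.norm_sum_basis, Tsirelson.norm_sum_basis]
  have hsupp : ((a.mapDomain Subtype.val).support : Set ℕ) ⊆ N := by
    intro n hn
    obtain ⟨m, -, rfl⟩ := Finset.mem_image.1 (Finsupp.mapDomain_support hn)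
    exact m.2
  have h0 := Tsirelson.tnorm_nonneg (S.single i₀) (a.mapDomain Subtype.val)
  refine ⟨?_, (hC _ hsupp).trans (mul_le_mul_of_nonneg_right (le_max_left _ _) h0)⟩
  exact (mul_le_of_le_one_left h0 (inv_le_one_of_one_le₀ (le_max_right _ _))).trans
    (Tsirelson.tnorm_single_le S i₀ _)
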